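/- Let $\mathcal A$ be a structure with finite domain $A$, $|A|=n$, over a finite signature consisting of relation symbols and possibly constant symbols. A positive Horn sentence is a prenex first-order sentence with quantifiers $\forall,\exists$ whose quantifier-free part is a conjunction of atoms (relational atoms and equalities, with variables and constant symbols as arguments); it is primitive positive if it has no universal quantifier. $\mathrm{QCSP}(\mathcal A)$ is the problem of deciding, for a given positive Horn sentence $\varphi$, whether $\mathcal A\models\varphi$; $\mathrm{CSP}(\mathcal A)$ is the same problem for primitive positive sentences. When every element of $A$ is named by a constant of $\mathcal A$ we write $\mathrm{QCSP}_c(\mathcal A)$, $\mathrm{CSP}_c(\mathcal A)$. A $k$-ary polymorphism of $\mathcal A$ ($k\ge 1$) is a homomorphism $\mathcal A^k\to\mathcal A$ (which preserves relations and constants). An adversary of length $m\ge1$ is a subset of $A^m$. Let $\mathbf\Omega=(\Omega_m)_{m\ge1}$, where $\Omega_m$ is a set of adversaries of length $m$, and let $\mathrm{width}(\Omega_m)=\sum_{\mathscr B\in\Omega_m}|\mathscr B|$. Suppose that: 1. (non-degenerate) for every $m\ge1$ and all $i\ne j$ in $\{1,\dots,m\}$ there are $\mathscr B\in\Omega_m$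 and $t\in\mathscr B$ with $t_i\neq t_j$ (i.e. in the product, over all $\mathscr B\in\Omega_m$ and $t\in\mathscr B$, of the expansions of $\mathcal A$ by constants $c_1,\dots,c_m$ interpreted as $t_1,\dots,t_m$, these $m$ constants are pairwise distinct); 2. (effective) there are a polynomial $q$ and an algorithm (Turing machine) that, given $m\ge1$ in unary, outputs $\Omega_m$ (listing the tuples of each of its adversaries) in time at most $q(m+\mathrm{width}(\Omega_m))$; 3. (projective) for every $m\ge1$ and every $\mathscr B\in\Omega_{n\cdot m}$ there is $\mathscr D\in\Omega_m$ such that, for every choice of one position in each of the $m$ consecutive blocks of $n$ positions, the projection of $\mathscr B$ onto the chosen $m$ positions is contained in $\mathscr D$; 4. (polynomially bounded) there is a polynomial $p$ with $\mathrm{width}(\Omega_m)\le p(m)$ for all $m\ge1$; 5. (generation) for every $m\ge1$, $\Omega_m$ generates $A^m$: for every $t\in A^m$ there are $k\ge1$, a $k$-ary polymorphism $f$ of $\mathcal A$ and $t_1,\dots,t_k\in\bigcup_{\mathscr B\in\Omega_m}\mathscr B$ with $f(t_1,\dots,t_k)=t$ (coordinatewise). Then: (a) For every expansion $\mathcal A'$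 of $\mathcal A$ by a finite (possibly empty) set of constants such that each element of $A$ that occurs in a tuple of an adversary in some $\Omega_m$, $m\ge1$, is named by at least one constant of $\mathcal A'$, the problem $\mathrm{QCSP}(\mathcal A)$ reduces in polynomial time (by a many-one reduction) to $\mathrm{CSP}(\mathcal A')$. (b) In particular, if every element of $A$ is named by a constant of $\mathcal A$, then $\mathrm{QCSP}_c(\mathcal A)$ reduces in polynomial time to $\mathrm{CSP}_c(\mathcal A)$. -/

import Mathlib

namespace QCSPReduction

/-! ### Positive Horn sentences, QCSP and CSP -/

/-- Quantifiers. -/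
inductive Quantifier where
  | all : Quantifier
  | ex : Quantifier

/-- Arguments of atoms: a variable or a constant symbol. -/
inductive Tm (L : FirstOrder.Language.{0, 0}) (V : Type) where
  | var : V → Tm L V
  | const : L.Constants → Tm L V

/-- Atomic formulas `R(s₁, …, sₖ)` and `s = t`. -/
inductive Atom (L : FirstOrder.Language.{0, 0}) (V : Type) where
  | rel : (k : ℕ) → L.Relations k → (Fin k → Tm L V) → Atom L V
  | eq : Tm L V → Tm L V → Atom L V

/-- A positive Horn sentence in prenex form: a quantifier prefix (outermost quantifier first)
followed by a conjunction of atoms.  Variable `i` is the one bound by the `i`-th quantifier. -/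
structure PHSentence (L : FirstOrder.Language.{0, 0}) where
  quants : List Quantifier
  matrix : List (Atom L (Fin quants.length))

/-- Primitive positive sentences: no universal quantifier. -/
def PPSentence (L : FirstOrder.Language.{0, 0}) : Type :=
  {φ : PHSentence L // ∀ q ∈ φ.quants, q = Quantifier.ex}

section Semantics

variable {L : FirstOrder.Language.{0, 0}} {A : Type} [L.Structure A]

/-- Value of a term under an assignment. -/
def Tm.eval {V : Type} (v : V → A) : Tm L V → A
  | .var x => v x
  | .const c => (c : A)

/-- Truth of an atom under an assignment. -/
def Atom.Holds {V : Type} (v : V → A) : Atom L V → Prop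
  | .rel _ r ts => FirstOrder.Language.Structure.RelMap r (fun i => (ts i).eval v)
  | .eq s t => s.eval v = t.eval v

/-- Truth of a quantifier prefix applied to a predicate on assignments. -/
def PrefixHolds (A : Type) : (qs : List Quantifier) → ((Fin qs.length → A) → Prop) → Prop
  | [], P => P Fin.elim0
  | .all :: qs, P => ∀ a : A, PrefixHolds A qs (fun v => P (Fin.cons a v))
  | .ex :: qs, P => ∃ a : A, PrefixHolds A qs (fun v => P (Fin.cons a v))

end Semantics

/-- `A ⊨ φ`. -/
def PHSentence.Holds {L : FirstOrder.Language.{0, 0}} (φ : PHSentence L) (A : Type) [L.Structure A] : Prop :=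
  PrefixHolds A φ.quants (fun v => ∀ α ∈ φ.matrix, α.Holds v)

/-- The problem `QCSP(A)`, as the set of its yes-instances. -/
def QCSP (L : FirstOrder.Language.{0, 0}) (A : Type) [L.Structure A] : Set (PHSentence L) :=
  {φ | φ.Holds A}

/-- The problem `CSP(A)`, as the set of its yes-instances. -/
def CSP (L : FirstOrder.Language.{0, 0}) (A : Type) [L.Structure A] : Set (PPSentence L) :=
  {φ | φ.1.Holds A}

/-! ### Encoding of sentences as words, and polynomial-time reductions -/

/-- The alphabet over which sentences are written. -/
inductive Sym (L : FirstOrder.Language.{0, 0}) where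
  | quant : Quantifier → Sym L
  | rel : (k : ℕ) → L.Relations k → Sym L
  | eq : Sym L
  | const : L.Constants → Sym L
  | var : Sym L
  | tick : Sym L

section Encoding

variable {L : FirstOrder.Language.{0, 0}}

/-- Variable `i` is written as the symbol `var` followed by `i` in unary; as `i` is smaller than
the number of quantifiers of the sentence, unary indices change lengths only polynomially. -/
def Tm.encode {N : ℕ} : Tm L (Fin N) → List (Sym L)
  | .var i => Sym.var :: List.replicate i Sym.tick
  | .const c => [Sym.const c]

/-- Prefix notation. -/
def Atom.encode {N : ℕ} : Atom L (Fin N) → List (Sym L)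
  | .rel k r ts => Sym.rel k r :: (List.ofFn fun i => (ts i).encode).flatten
  | .eq s t => Sym.eq :: (s.encode ++ t.encode)

/-- The quantifier prefix followed by the atoms. -/
def PHSentence.encode (φ : PHSentence L) : List (Sym L) :=
  φ.quants.map Sym.quant ++ (φ.matrix.map Atom.encode).flatten

/-- The same encoding for primitive positive sentences. -/
def PPSentence.encode (φ : PPSentence L) : List (Sym L) :=
  PHSentence.encode φ.1

end Encoding

/-- Polynomial-time many-one reducibility of the problem `P` to the problem `Q`, for instances
written as words by `ea` and `eb`, by a function computed by a polynomial-time Turing machine. -/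
def PolyTimeReducible {α β αΓ βΓ : Type} (ea : α → List αΓ) (eb : β → List βΓ)
    (P : Set α) (Q : Set β) : Prop :=
  ∃ f : α → β, Nonempty (Turing.TM2ComputableInPolyTime ea eb f) ∧ ∀ x, x ∈ P ↔ f x ∈ Q

/-! ### Powers and polymorphisms -/

/-- The domain of the power `A^k`. -/
abbrev Power (A : Type) (k : ℕ) : Type := Fin k → A

/-- The power `A^k` as a structure: everything is coordinatewise. -/
instance Power.structure (L : FirstOrder.Language.{0, 0}) (A : Type) [L.Structure A] (k : ℕ) :
    L.Structure (Power A k) where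
  funMap g x := fun j => FirstOrder.Language.Structure.funMap g (fun i => x i j)
  RelMap r x := ∀ j, FirstOrder.Language.Structure.RelMap r (fun i => x i j)

/-- `k`-ary polymorphisms: homomorphisms from `A^k` to `A` (they preserve the constants too). -/
abbrev Polymorphism (L : FirstOrder.Language.{0, 0}) (A : Type) [L.Structure A] (k : ℕ) : Type :=
  FirstOrder.Language.Hom L (Power A k) A

/-! ### Adversaries -/

/-- An adversary of length `m`: an `m`-ary relation on the finite set `A`. -/
abbrev Adversary (A : Type) (m : ℕ) : Type := Finset (Fin m → A)

/-- A sequence `(Ω_m)` of sets of adversaries, `Ω_m` having adversaries of length `m`.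
Only the members with `m ≥ 1` play a role. -/
abbrev AdversarySeq (A : Type) : Type := (m : ℕ) → Finset (Adversary A m)

/-- `width(Ω_m)`, the sum of the sizes of its adversaries. -/
def width {A : Type} {m : ℕ} (Ω : Finset (Adversary A m)) : ℕ := ∑ B ∈ Ω, B.card

/-- `Ω` is polynomially bounded. -/
def PolynomiallyBounded {A : Type} (Ω : AdversarySeq A) : Prop :=
  ∃ p : Polynomial ℕ, ∀ m, 1 ≤ m → width (Ω m) ≤ p.eval m

/-- The interpretation of the `m` constants `c₁, …, c_m` in the product, over all adversaries `B`
of `Ω_m` and all `μ ∈ B`, of the expansions of `A` by `c_j ↦ μ(j)`. -/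
def productConstant {A : Type} {m : ℕ} (Ω : Finset (Adversary A m)) (j : Fin m) :
    (Σ B : {B // B ∈ Ω}, {μ // μ ∈ B.1}) → A :=
  fun x => x.2.1 j

/-- `Ω_m` is not degenerate: in that product the `m` constants are pairwise distinct. -/
def NonDegenerate {A : Type} {m : ℕ} (Ω : Finset (Adversary A m)) : Prop :=
  Function.Injective (productConstant Ω)

/-- `Ω_m` generates the adversary `S`: each tuple of `S` is the image of finitely many tuples, each
lying in some adversary of `Ω_m`, under a polymorphism of `A` (applied coordinatewise). -/
def Generates (L : FirstOrder.Language.{0, 0}) {A : Type} [L.Structure A] {m : ℕ}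
    (Ω : Finset (Adversary A m)) (S : Adversary A m) : Prop :=
  ∀ t ∈ S, ∃ (k : ℕ) (_ : 1 ≤ k) (f : Polymorphism L A k) (ts : Fin k → Fin m → A),
    (∀ r, ∃ B ∈ Ω, ts r ∈ B) ∧ ∀ i, f (fun r => ts r i) = t i

/-- Split the `m * n` positions into `m` consecutive blocks of size `n`; keep in block `j` only
its position `s j`. -/
def projectAdversary {A : Type} [DecidableEq A] {m n : ℕ} (B : Adversary A (m * n))
    (s : Fin m → Fin n) : Adversary A m :=
  B.image (fun t j => t (finProdFinEquiv (j, s j)))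

/-- `Ω` is projective: with `n = |A|`, for all `m ≥ 1` and `B ∈ Ω_{n·m}` there is one adversary of
`Ω_m` that dominates all the projections of `B` with one position kept in each block. -/
def Projective {A : Type} [Fintype A] [DecidableEq A] (Ω : AdversarySeq A) : Prop :=
  ∀ m, 1 ≤ m → ∀ B ∈ Ω (m * Fintype.card A), ∃ D ∈ Ω m,
    ∀ s : Fin m → Fin (Fintype.card A), projectAdversary B s ⊆ D

/-- The alphabet over which a set of adversaries is written. -/
inductive AdvSym (A : Type) where
  | elem : A → AdvSym A
  | tupleEnd : AdvSym A
  | advEnd : AdvSym A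

/-- A list of lists of tuples as a word. -/
def encodeAdversaries {A : Type} {m : ℕ} (l : List (List (Fin m → A))) : List (AdvSym A) :=
  (l.map fun B =>
    (B.map fun t => (List.ofFn t).map AdvSym.elem ++ [AdvSym.tupleEnd]).flatten
      ++ [AdvSym.advEnd]).flatten

/-- `Ω` is effective: a Turing machine which is given `m ≥ 1` in unary writes out `Ω_m`
(all its adversaries, each one as the list of its tuples, in some order)
in time polynomial in `m + width(Ω_m)`. -/
def Effective {A : Type} [DecidableEq A] (Ω : AdversarySeq A) : Prop :=
  ∃ (enum : (m : ℕ) → List (List (Fin m → A))) (p : Polynomial ℕ)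
    (M : Turing.TM2ComputableAux Unit (AdvSym A)),
    ∀ m, 1 ≤ m →
      ((enum m).map List.toFinset).toFinset = Ω m ∧
      Nonempty (Turing.TM2OutputsInTime M.tm
        ((List.replicate m ()).map M.inputAlphabet.invFun)
        (some ((encodeAdversaries (enum m)).map M.outputAlphabet.invFun))
        (p.eval (m + width (Ω m))))

end QCSPReduction

/-! Let `ψ` have `N` quantified variables. `ψ` holds iff the existential player has a winning
strategy: a map from plays of the opponent to assignments in which a universal variable takes its
played value and an existential variable depends only on earlier entries
(`prefixHolds_iff_exists_isStrategy`). The reduction asks for such a strategy only against the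
tuples ("rows") of the adversaries in `Ω_{N+1}`. This is a primitive positive condition: each row
gets its own copy of the variables and of the matrix, universal variables are equated with the
constants naming the row's entries, and copies of an existential variable are equated for any two
rows that agree before it (`reduce`, `reduce_mem_csp_iff`). The length is `N + 1` because nothing is
assumed about `Ω_0`.

A winning strategy clearly restricts to the rows. Conversely (`mem_qcsp_iff_reduce_mem_csp`),
consider the tuple of length `(N + 1) * n` each of whose blocks lists all of `A`. By generation it
is `f(t₁, …, t_k)` for a polymorphism `f` and tuples `t_r` from `Ω_{(N+1)n}`. For a play `x`, keep
in block `j` the position of `x j`: by projectivity each `t_r` becomes a row, and `f` maps these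
rows to `x`. Applying `f` to the answers given for these rows is a strategy against `x`. It wins
because polymorphisms preserve conjunctions of atoms, and it respects the order of play because
plays agreeing before `i` select rows agreeing before `i`.

For the running time, the number of rows is polynomial in `N` and they are produced by the given
enumerator, so the sentence can be written in polynomial time. The machine is assembled from modules
with Hoare-style specifications (`Module.Run`, `Does`, `LoopsOver`); it runs the enumerator as a
subroutine and writes `atomsWord` (`exists_run_reduceProg`), which is the encoding of `reduce`
(`encode_reduce`). All is combined in `polyTimeReducible_of_expansion`. -/

namespace QCSPReduction

open Turing (TM2.Stmt TM2.Cfg TM2.step TM2.stepAux)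

/-! ### Modules of stack machines -/

section Steps

variable {K : Type} [DecidableEq K] {Γ : K → Type} {Λ σ : Type}

/-- `c` evolves to `c'` in exactly `n` steps. -/
def Steps (M : Λ → TM2.Stmt Γ Λ σ) (n : ℕ) (c c' : TM2.Cfg Γ Λ σ) : Prop :=
  (flip bind (TM2.step M))^[n] (some c) = some c'

theorem Steps.refl (M : Λ → TM2.Stmt Γ Λ σ) (c : TM2.Cfg Γ Λ σ) : Steps M 0 c c := rfl

theorem Steps.head {M : Λ → TM2.Stmt Γ Λ σ} {n : ℕ} {c c₁ c' : TM2.Cfg Γ Λ σ}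
    (h : TM2.step M c = some c₁) (h' : Steps M n c₁ c') : Steps M (n + 1) c c' := by
  unfold Steps
  rw [Function.iterate_succ_apply, show flip bind (TM2.step M) (some c) = some c₁ from h]
  exact h'

theorem Steps.exists_head {M : Λ → TM2.Stmt Γ Λ σ} {n : ℕ} {c c' : TM2.Cfg Γ Λ σ}
    (h : Steps M (n + 1) c c') : ∃ c₁, TM2.step M c = some c₁ ∧ Steps M n c₁ c' := by
  unfold Steps at h
  rw [Function.iterate_succ_apply] at h
  cases hc : TM2.step M c with
  | none =>
    have hn : (flip bind (TM2.step M) (some c)) = none := by simp [flip, hc]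
    rw [hn, Function.iterate_fixed (by rfl)] at h
    exact absurd h (by simp)
  | some c₁ => exact ⟨c₁, rfl, by simpa [flip, hc, Steps] using h⟩

theorem Steps.trans {M : Λ → TM2.Stmt Γ Λ σ} {n n' : ℕ} {c c' c'' : TM2.Cfg Γ Λ σ}
    (h : Steps M n c c') (h' : Steps M n' c' c'') : Steps M (n' + n) c c'' := by
  unfold Steps at *
  rw [Function.iterate_add_apply, h, h']

theorem Steps.map {Λ' σ' K' : Type} [DecidableEq K'] {Γ' : K' → Type}
    {M : Λ → TM2.Stmt Γ Λ σ} {N : Λ' → TM2.Stmt Γ' Λ' σ'}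
    (F : TM2.Cfg Γ Λ σ → TM2.Cfg Γ' Λ' σ')
    (hF : ∀ c c₁, TM2.step M c = some c₁ → TM2.step N (F c) = some (F c₁)) {n : ℕ}
    {c c' : TM2.Cfg Γ Λ σ} (h : Steps M n c c') : Steps N n (F c) (F c') := by
  induction n generalizing c with
  | zero => cases h; exact Steps.refl _ _
  | succ n ih =>
    obtain ⟨c₁, h₁, h₂⟩ := h.exists_head
    exact Steps.head (hF _ _ h₁) (ih h₂)

end Steps

section Relabel

variable {K : Type} [DecidableEq K] {Γ : K → Type} {Λ Λ' σ : Type}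

/-- Rename the labels of a statement, and continue at `x` where it halts. -/
def relabel (e : Λ → Λ') (x : Option Λ') : TM2.Stmt Γ Λ σ → TM2.Stmt Γ Λ' σ
  | .push k f q => .push k f (relabel e x q)
  | .peek k f q => .peek k f (relabel e x q)
  | .pop k f q => .pop k f (relabel e x q)
  | .load f q => .load f (relabel e x q)
  | .branch f q₁ q₂ => .branch f (relabel e x q₁) (relabel e x q₂)
  | .goto f => .goto fun v => e (f v)
  | .halt => x.elim .halt fun l => .goto fun _ => l

/-- The effect of `relabel` on configurations. -/
def relabelCfg (e : Λ → Λ') (x : Option Λ') (c : TM2.Cfg Γ Λ σ) : TM2.Cfg Γ Λ' σ :=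
  ⟨c.l.elim x fun l => some (e l), c.var, c.stk⟩

theorem stepAux_relabel (e : Λ → Λ') (x : Option Λ') (q : TM2.Stmt Γ Λ σ) (v : σ)
    (S : ∀ k, List (Γ k)) :
    TM2.stepAux (relabel e x q) v S = relabelCfg e x (TM2.stepAux q v S) := by
  induction q generalizing v S with
  | push k f q ih => simp [relabel, ih]
  | peek k f q ih => simp [relabel, ih]
  | pop k f q ih => simp [relabel, ih]
  | load f q ih => simp [relabel, ih]
  | branch f q₁ q₂ ih₁ ih₂ => cases h : f v <;> simp [relabel, ih₁, ih₂, h]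
  | goto f => simp [relabel, relabelCfg]
  | halt => cases x <;> simp [relabel, relabelCfg]

theorem Steps.relabel {M : Λ → TM2.Stmt Γ Λ σ} {N : Λ' → TM2.Stmt Γ Λ' σ} (e : Λ → Λ')
    (x : Option Λ') (hN : ∀ l, N (e l) = relabel e x (M l)) {n : ℕ} {c c' : TM2.Cfg Γ Λ σ}
    (h : Steps M n c c') : Steps N n (relabelCfg e x c) (relabelCfg e x c') := by
  refine h.map _ ?_
  rintro ⟨l, v, S⟩ c₁ h₁
  cases l with
  | none => simp at h₁
  | some l =>
    simp only [TM2.step, Option.some.injEq] at h₁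
    subst h₁
    simp [relabelCfg, hN, stepAux_relabel]

end Relabel

/-- A program with one entry; halting is its exit. -/
structure Module {K : Type} (Γ : K → Type) (σ : Type) where
  Label : Type
  finite_label : Finite Label
  main : Label
  code : Label → TM2.Stmt Γ Label σ

namespace Module

variable {K : Type} [DecidableEq K] {Γ : K → Type} {σ : Type}

/-- From any internal state, `P` turns the stacks `S` into `S'` in at most `t` steps. -/
def Run (P : Module Γ σ) (S S' : ∀ k, List (Γ k)) (t : ℕ) : Prop :=
  ∀ v, ∃ v' n, n ≤ t ∧ Steps P.code n ⟨some P.main, v, S⟩ ⟨none, v', S'⟩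

theorem Run.mono {P : Module Γ σ} {S S' : ∀ k, List (Γ k)} {t t' : ℕ} (h : P.Run S S' t)
    (ht : t ≤ t') : P.Run S S' t' := fun v =>
  let ⟨v', n, hn, h'⟩ := h v
  ⟨v', n, hn.trans ht, h'⟩

theorem Run.of_eq {P : Module Γ σ} {S S' S₁ S₁' : ∀ k, List (Γ k)} {t : ℕ} (h : P.Run S S' t)
    (hS : S = S₁) (hS' : S' = S₁') : P.Run S₁ S₁' t := by
  subst hS hS'
  exact h

/-- Do nothing. -/
def skip : Module Γ σ := ⟨Unit, inferInstance, (), fun _ => .halt⟩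

theorem run_skip (S : ∀ k, List (Γ k)) : (skip : Module Γ σ).Run S S 1 := fun v =>
  ⟨v, 1, le_rfl, Steps.head rfl (Steps.refl _ _)⟩

/-- Push a symbol. -/
def push (k : K) (a : Γ k) : Module Γ σ :=
  ⟨Unit, inferInstance, (), fun _ => .push k (fun _ => a) .halt⟩

theorem run_push (k : K) (a : Γ k) (S : ∀ k, List (Γ k)) :
    (push k a : Module Γ σ).Run S (Function.update S k (a :: S k)) 1 := fun v =>
  ⟨v, 1, le_rfl, Steps.head rfl (Steps.refl _ _)⟩

/-- Sequential composition. -/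
def seq (P Q : Module Γ σ) : Module Γ σ where
  Label := P.Label ⊕ Q.Label
  finite_label := have := P.finite_label; have := Q.finite_label; inferInstance
  main := .inl P.main
  code := Sum.elim (fun l => relabel .inl (some (.inr Q.main)) (P.code l))
    (fun l => relabel .inr none (Q.code l))

/-- Halting of `P` is rewritten into a jump to `Q`, so composition costs no extra step. `Q` starts
in whatever internal state `P` leaves, which is why `Run` quantifies over all states. -/
theorem Run.seq {P Q : Module Γ σ} {S S' S'' : ∀ k, List (Γ k)} {t t' : ℕ} (h : P.Run S S' t)
    (h' : Q.Run S' S'' t') : (P.seq Q).Run S S'' (t + t') := fun v => by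
  obtain ⟨v₁, n₁, hn₁, h₁⟩ := h v
  obtain ⟨v₂, n₂, hn₂, h₂⟩ := h' v₁
  have h₁' := h₁.relabel (N := (P.seq Q).code) .inl (some (.inr Q.main)) fun _ => rfl
  have h₂' := h₂.relabel (N := (P.seq Q).code) .inr none fun _ => rfl
  exact ⟨v₂, n₂ + n₁, by omega, h₁'.trans h₂'⟩

/-- A way to store the result of a pop from the stack `k` in the internal state. -/
structure Reader (Γ : K → Type) (σ : Type) (k : K) where
  write : σ → Option (Γ k) → σ
  read : σ → Option (Γ k)
  read_write : ∀ v o, read (write v o) = o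

/-- Pop a symbol and branch on it. -/
def pop {k : K} [Finite (Γ k)] (R : Reader Γ σ k) (P : Option (Γ k) → Module Γ σ) :
    Module Γ σ where
  Label := Unit ⊕ Σ o, (P o).Label
  finite_label := have := fun o => (P o).finite_label; inferInstance
  main := .inl ()
  code := Sum.elim
    (fun _ => .pop k R.write (.goto fun v => .inr ⟨R.read v, (P (R.read v)).main⟩))
    (fun l => relabel (fun l' => .inr ⟨l.1, l'⟩) none ((P l.1).code l.2))

theorem Run.pop {k : K} [Finite (Γ k)] (R : Reader Γ σ k) {P : Option (Γ k) → Module Γ σ}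
    {S S' : ∀ k, List (Γ k)} {t : ℕ}
    (h : (P (S k).head?).Run (Function.update S k (S k).tail) S' t) :
    (pop R P).Run S S' (t + 1) := fun v => by
  obtain ⟨v', n, hn, h⟩ := h (R.write v (S k).head?)
  have h' := h.relabel (N := (Module.pop R P).code) (fun l' => .inr ⟨_, l'⟩) none fun _ => rfl
  -- The type of the target label depends on the symbol read, so the equation is stated for a
  -- variable `o` and only then specialised.
  have key : ∀ o, R.read (R.write v (S k).head?) = o →
      TM2.step (Module.pop R P).code ⟨some (Module.pop R P).main, v, S⟩ =
        some ⟨some (.inr ⟨o, (P o).main⟩), R.write v (S k).head?,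
          Function.update S k (S k).tail⟩ := by
    rintro _ rfl
    rfl
  exact ⟨v', n + 1, by omega, Steps.head (key _ (R.read_write _ _)) h'⟩

/-- Pop the symbols of a stack until it is empty, running a program after each pop. -/
def loop {k : K} [Finite (Γ k)] (R : Reader Γ σ k) (P : Γ k → Module Γ σ) : Module Γ σ where
  Label := Unit ⊕ Σ a, (P a).Label
  finite_label := have := fun o => (P o).finite_label; inferInstance
  main := .inl ()
  code := Sum.elim
    (fun _ => .pop k R.write (.branch (fun v => (R.read v).isNone) .halt
      (.goto fun v => (R.read v).elim (.inl ()) fun a => .inr ⟨a, (P a).main⟩)))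
    (fun l => relabel (fun l' => .inr ⟨l.1, l'⟩) (some (.inl ())) ((P l.1).code l.2))

theorem run_loop_nil {k : K} [Finite (Γ k)] (R : Reader Γ σ k) (P : Γ k → Module Γ σ)
    {S : ∀ k, List (Γ k)} (h : S k = []) : (loop R P).Run S S 1 := fun v => by
  refine ⟨R.write v none, 1, le_rfl, Steps.head ?_ (Steps.refl _ _)⟩
  have hS : Function.update S k [] = S := by rw [← h, Function.update_eq_self]
  simp [loop, h, R.read_write, hS]

/-- Pop, emptiness test and jump form one `TM2` step, the `+ 1`; the exit of the body leads back to
the head of the loop. -/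
theorem run_loop_cons {k : K} [Finite (Γ k)] (R : Reader Γ σ k) {P : Γ k → Module Γ σ}
    {S S' S'' : ∀ k, List (Γ k)} {a : Γ k} {l : List (Γ k)} {t t' : ℕ} (hS : S k = a :: l)
    (h : (P a).Run (Function.update S k l) S' t) (h' : (loop R P).Run S' S'' t') :
    (loop R P).Run S S'' (t + t' + 1) := fun v => by
  obtain ⟨v₁, n₁, hn₁, h₁⟩ := h (R.write v (some a))
  obtain ⟨v₂, n₂, hn₂, h₂⟩ := h' v₁
  have h₁' := h₁.relabel (N := (loop R P).code) (fun l' => .inr ⟨a, l'⟩) (some (.inl ()))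
    fun _ => rfl
  refine ⟨v₂, n₂ + n₁ + 1, by omega, Steps.head ?_ (h₁'.trans h₂)⟩
  simp [loop, hS, R.read_write, relabelCfg]

end Module

end QCSPReduction

namespace QCSPReduction

open Turing (TM2.Stmt TM2.Cfg TM2.step TM2.stepAux)

/-! ### Machines as subroutines -/

section Embed

variable {K₁ K₂ : Type} [DecidableEq K₁] [DecidableEq K₂] {Γ₁ : K₁ → Type} {Γ₂ : K₂ → Type}
  {Λ ρ σ : Type}

/-- The stacks `W` together with the stacks `T`. -/
def combine (W : ∀ k, List (Γ₁ k)) (T : ∀ k, List (Γ₂ k)) :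
    ∀ k, List (Sum.elim Γ₁ Γ₂ k)
  | .inl k => W k
  | .inr k => T k

theorem update_combine_inl (W : ∀ k, List (Γ₁ k)) (T : ∀ k, List (Γ₂ k)) (k : K₁)
    (x : List (Γ₁ k)) :
    Function.update (combine W T) (.inl k) x = combine (Function.update W k x) T := by
  funext j
  rcases j with j | j
  · rcases eq_or_ne j k with rfl | h
    · exact (Function.update_self ..).trans (Function.update_self (β := fun k => List (Γ₁ k)) ..).symm
    · exact (Function.update_of_ne (fun h' => h (Sum.inl.inj h')) ..).trans
        (Function.update_of_ne (β := fun k => List (Γ₁ k)) h ..).symm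
  · exact Function.update_of_ne Sum.inr_ne_inl ..

theorem update_combine_inr (W : ∀ k, List (Γ₁ k)) (T : ∀ k, List (Γ₂ k)) (k : K₂)
    (x : List (Γ₂ k)) :
    Function.update (combine W T) (.inr k) x = combine W (Function.update T k x) := by
  funext j
  rcases j with j | j
  · exact Function.update_of_ne Sum.inl_ne_inr ..
  · rcases eq_or_ne j k with rfl | h
    · exact (Function.update_self ..).trans (Function.update_self (β := fun k => List (Γ₂ k)) ..).symm
    · exact (Function.update_of_ne (fun h' => h (Sum.inr.inj h')) ..).trans
        (Function.update_of_ne (β := fun k => List (Γ₂ k)) h ..).symm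

/-- A statement acting on the right-hand stacks and the second part of the state. -/
def embed : TM2.Stmt Γ₂ Λ σ → TM2.Stmt (Sum.elim Γ₁ Γ₂) Λ (ρ × σ)
  | .push k f q => .push (.inr k) (fun v => f v.2) (embed q)
  | .peek k f q => .peek (.inr k) (fun v o => (v.1, f v.2 o)) (embed q)
  | .pop k f q => .pop (.inr k) (fun v o => (v.1, f v.2 o)) (embed q)
  | .load f q => .load (fun v => (v.1, f v.2)) (embed q)
  | .branch f q₁ q₂ => .branch (fun v => f v.2) (embed q₁) (embed q₂)
  | .goto f => .goto fun v => f v.2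
  | .halt => .halt

/-- The effect of `embed` on configurations. -/
def embedCfg (r : ρ) (W : ∀ k, List (Γ₁ k)) (c : TM2.Cfg Γ₂ Λ σ) :
    TM2.Cfg (Sum.elim Γ₁ Γ₂) Λ (ρ × σ) :=
  ⟨c.l, (r, c.var), combine W c.stk⟩

theorem stepAux_embed (r : ρ) (W : ∀ k, List (Γ₁ k)) (q : TM2.Stmt Γ₂ Λ σ) (v : σ)
    (T : ∀ k, List (Γ₂ k)) :
    TM2.stepAux (embed q) (r, v) (combine W T) = embedCfg r W (TM2.stepAux q v T) := by
  induction q generalizing v T with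
  | push k f q ih => 
    exact (congrArg (TM2.stepAux (embed q) _) (update_combine_inr W T k _)).trans (ih _ _)
  | peek k f q ih => exact ih _ _
  | pop k f q ih => 
    exact (congrArg (TM2.stepAux (embed q) _) (update_combine_inr W T k _)).trans (ih _ _)
  | load f q ih => exact ih _ _
  | branch f q₁ q₂ ih₁ ih₂ => cases h : f v <;> simp [embed, ih₁, ih₂, h]
  | goto f => rfl
  | halt => rfl

namespace Module

/-- Run a machine from its initial state. -/
def call [Finite Λ] (main : Λ) (init : σ) (M : Λ → TM2.Stmt Γ₂ Λ σ) :
    Module (Sum.elim Γ₁ Γ₂) (ρ × σ) where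
  Label := Unit ⊕ Λ
  finite_label := inferInstance
  main := .inl ()
  code := Sum.elim (fun _ => .load (fun v => (v.1, init)) (.goto fun _ => .inr main))
    (fun l => relabel .inr none (embed (M l)))

/-- The machine is only known to behave well from its initial state, so one extra step loads `init`.
The stacks `W` and the first state component are left alone. -/
theorem run_call [Finite Λ] {main : Λ} {init v' : σ} {M : Λ → TM2.Stmt Γ₂ Λ σ}
    (W : ∀ k, List (Γ₁ k)) {T T' : ∀ k, List (Γ₂ k)} {n : ℕ}
    (h : Steps M n ⟨some main, init, T⟩ ⟨none, v', T'⟩) :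
    (call main init M : Module (Sum.elim Γ₁ Γ₂) (ρ × σ)).Run (combine W T) (combine W T')
      (n + 1) := fun v => by
  have h₁ : Steps (fun l => (embed (M l) : TM2.Stmt (Sum.elim Γ₁ Γ₂) Λ (ρ × σ))) n _ _ :=
    h.map (embedCfg v.1 W) <| by
      rintro ⟨l, v, S⟩ c₁ h₁
      cases l with
      | none => simp at h₁
      | some l =>
        simp only [TM2.step, Option.some.injEq] at h₁
        subst h₁
        exact congrArg some (stepAux_embed ..)
  have h₂ := h₁.relabel (N := (call main init M : Module (Sum.elim Γ₁ Γ₂) (ρ × σ)).code) .inr none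
    fun _ => rfl
  exact ⟨(v.1, v'), n + 1, le_rfl, Steps.head rfl h₂⟩

end Module

end Embed

/-! ### Stack growth is bounded by running time -/

section Growth

variable {K : Type} [DecidableEq K] {Γ : K → Type} {Λ σ : Type}

/-- The number of push instructions of a statement. -/
def pushCount : TM2.Stmt Γ Λ σ → ℕ
  | .push _ _ q => pushCount q + 1
  | .peek _ _ q => pushCount q
  | .pop _ _ q => pushCount q
  | .load _ q => pushCount q
  | .branch _ q₁ q₂ => pushCount q₁ + pushCount q₂
  | .goto _ => 0
  | .halt => 0

theorem length_stepAux_le (q : TM2.Stmt Γ Λ σ) (v : σ) (S : ∀ k, List (Γ k)) (k : K) :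
    ((TM2.stepAux q v S).stk k).length ≤ (S k).length + pushCount q := by
  induction q generalizing v S with
  | push k' f q ih =>
    refine (ih _ _).trans ?_
    rcases eq_or_ne k k' with rfl | h
    · simp [pushCount]; omega
    · simp [pushCount, h]
  | peek k' f q ih => exact ih _ _
  | pop k' f q ih =>
    refine (ih _ _).trans ?_
    rcases eq_or_ne k k' with rfl | h
    · simp [pushCount]
    · simp [pushCount, h]
  | load f q ih => exact ih _ _
  | branch f q₁ q₂ ih₁ ih₂ =>
    cases h : f v
    · simpa [h, pushCount] using (ih₂ v S).trans (by omega)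
    · simpa [h, pushCount] using (ih₁ v S).trans (by omega)
  | goto f => simp
  | halt => simp

/-- A machine extends its stacks by a bounded number of symbols in each step. -/
theorem Steps.exists_length_le [Finite Λ] (M : Λ → TM2.Stmt Γ Λ σ) :
    ∃ b, ∀ n c c', Steps M n c c' → ∀ k, (c'.stk k).length ≤ (c.stk k).length + b * n := by
  have := Fintype.ofFinite Λ
  refine ⟨∑ l, pushCount (M l), fun n => ?_⟩
  induction n with
  | zero => rintro c c' h k; cases h; simp
  | succ n ih =>
    rintro ⟨l, v, S⟩ c' h k
    obtain ⟨c₁, h₁, h₂⟩ := h.exists_head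
    cases l with
    | none => simp at h₁
    | some l =>
      simp only [TM2.step, Option.some.injEq] at h₁
      subst h₁
      have hl : pushCount (M l) ≤ ∑ l, pushCount (M l) :=
        Finset.single_le_sum (f := fun l => pushCount (M l)) (fun _ _ => Nat.zero_le _)
          (Finset.mem_univ l)
      calc (c'.stk k).length ≤ _ := ih _ _ h₂ k
        _ ≤ (S k).length + pushCount (M l) + (∑ l, pushCount (M l)) * n := by
            gcongr; exact length_stepAux_le ..
        _ ≤ _ := by simp only [Nat.mul_succ]; omega

end Growth

/-! ### Translation between `TM2OutputsInTime` and `Steps` -/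

section FinTM2

open Turing

theorem initList_eq (tm : FinTM2) (s : List (tm.Γ tm.k₀)) :
    initList tm s = ⟨some tm.main, tm.initialState, Function.update (fun _ => []) tm.k₀ s⟩ := by
  unfold initList
  congr 1
  funext k
  rcases eq_or_ne k tm.k₀ with rfl | h
  · simp
  · simp [h]

theorem haltList_eq (tm : FinTM2) (s : List (tm.Γ tm.k₁)) :
    haltList tm s = ⟨none, tm.initialState, Function.update (fun _ => []) tm.k₁ s⟩ := by
  unfold haltList
  congr 1
  funext k
  rcases eq_or_ne k tm.k₁ with rfl | h
  · simp
  · simp [h]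

theorem TM2OutputsInTime.exists_steps {tm : FinTM2} {l : List (tm.Γ tm.k₀)}
    {l' : List (tm.Γ tm.k₁)} {t : ℕ} (h : Nonempty (TM2OutputsInTime tm l (some l') t)) :
    ∃ n ≤ t, Steps tm.m n
      ⟨some tm.main, tm.initialState, Function.update (fun _ => []) tm.k₀ l⟩
      ⟨none, tm.initialState, Function.update (fun _ => []) tm.k₁ l'⟩ := by
  obtain ⟨⟨n, hn⟩, ht⟩ := h
  rw [← initList_eq, ← haltList_eq]
  exact ⟨n, ht, hn⟩

theorem TM2OutputsInTime.nonempty_of_steps {tm : FinTM2} {l : List (tm.Γ tm.k₀)}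
    {l' : List (tm.Γ tm.k₁)} {n t : ℕ} (hn : n ≤ t) (h : Steps tm.m n
      ⟨some tm.main, tm.initialState, Function.update (fun _ => []) tm.k₀ l⟩
      ⟨none, tm.initialState, Function.update (fun _ => []) tm.k₁ l'⟩) :
    Nonempty (TM2OutputsInTime tm l (some l') t) := by
  rw [← initList_eq, ← haltList_eq] at h
  exact ⟨⟨⟨n, h⟩, hn⟩⟩

end FinTM2

end QCSPReduction

namespace QCSPReduction

open Turing (TM2.Stmt TM2.Cfg TM2.step TM2.stepAux)

/-! ### The stacks of the reduction -/

/-- The work stacks. -/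
inductive Wk
  | inp | outp | acc | qs | qsB | mat | matB | raw | rows | rowsC | rowsB
  | elC | elR | el1 | el2 | elR2 | o1 | o2 | ix | tk
  deriving DecidableEq

/-- The alphabets of the work stacks. -/
abbrev WkSym (L L' : FirstOrder.Language.{0, 0}) (A : Type) : Wk → Type
  | .inp | .mat | .matB => Sym L
  | .outp | .acc => Sym L'
  | .qs | .qsB => Quantifier
  | .raw | .rows | .rowsC | .rowsB => Option A
  | .elC | .elR | .el1 | .el2 | .elR2 => A
  | .o1 | .o2 | .ix | .tk => Unit

instance : Finite Quantifier :=
  Finite.of_injective (β := Bool) (fun | .all => true | .ex => false)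
    (by rintro (_ | _) (_ | _) h <;> simp_all)

instance WkSym.finite (L L' : FirstOrder.Language.{0, 0}) (A : Type) [Finite (Sym L)]
    [Finite (Sym L')] [Finite A] (w : Wk) : Finite (WkSym L L' A w) := by
  cases w <;> simp only [WkSym] <;> infer_instance

/-- The contents of the work stacks. -/
structure Stacks (L L' : FirstOrder.Language.{0, 0}) (A : Type) where
  inp : List (Sym L) := []
  outp : List (Sym L') := []
  acc : List (Sym L') := []
  qs : List Quantifier := []
  qsB : List Quantifier := []
  mat : List (Sym L) := []
  matB : List (Sym L) := []
  raw : List (Option A) := []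
  rows : List (Option A) := []
  rowsC : List (Option A) := []
  rowsB : List (Option A) := []
  elC : List A := []
  elR : List A := []
  el1 : List A := []
  el2 : List A := []
  elR2 : List A := []
  o1 : List Unit := []
  o2 : List Unit := []
  ix : List Unit := []
  tk : List Unit := []

section Stacks

variable {L L' : FirstOrder.Language.{0, 0}} {A : Type}

/-- The content of a stack. -/
def Stacks.get (s : Stacks L L' A) : (w : Wk) → List (WkSym L L' A w)
  | .inp => s.inp | .outp => s.outp | .acc => s.acc | .qs => s.qs | .qsB => s.qsB
  | .mat => s.mat | .matB => s.matB | .raw => s.raw | .rows => s.rows | .rowsC => s.rowsC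
  | .rowsB => s.rowsB | .elC => s.elC | .elR => s.elR | .el1 => s.el1 | .el2 => s.el2
  | .elR2 => s.elR2 | .o1 => s.o1 | .o2 => s.o2 | .ix => s.ix | .tk => s.tk

/-- Replace the content of a stack. -/
def Stacks.upd (s : Stacks L L' A) : (w : Wk) → List (WkSym L L' A w) → Stacks L L' A
  | .inp, x => { s with inp := x } | .outp, x => { s with outp := x }
  | .acc, x => { s with acc := x } | .qs, x => { s with qs := x }
  | .qsB, x => { s with qsB := x } | .mat, x => { s with mat := x }
  | .matB, x => { s with matB := x } | .raw, x => { s with raw := x }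
  | .rows, x => { s with rows := x } | .rowsC, x => { s with rowsC := x }
  | .rowsB, x => { s with rowsB := x } | .elC, x => { s with elC := x }
  | .elR, x => { s with elR := x } | .el1, x => { s with el1 := x }
  | .el2, x => { s with el2 := x } | .elR2, x => { s with elR2 := x }
  | .o1, x => { s with o1 := x } | .o2, x => { s with o2 := x }
  | .ix, x => { s with ix := x } | .tk, x => { s with tk := x }

theorem Stacks.update_get (s : Stacks L L' A) (w : Wk) (x : List (WkSym L L' A w)) :
    Function.update s.get w x = (s.upd w x).get := by
  funext j
  rcases eq_or_ne j w with rfl | h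
  · rw [Function.update_self]; cases j <;> rfl
  · rw [Function.update_of_ne h]
    cases w <;> cases j <;> first | rfl | exact absurd rfl h

theorem Stacks.get_upd (s : Stacks L L' A) (w : Wk) (x : List (WkSym L L' A w)) :
    (s.upd w x).get w = x := by
  rw [← update_get, Function.update_self]

theorem Stacks.upd_upd (s : Stacks L L' A) (w : Wk) (x y : List (WkSym L L' A w)) :
    (s.upd w x).upd w y = s.upd w y := by
  cases w <;> rfl

end Stacks

/-! ### Programs on the work stacks and loop rules -/

section Programs

variable {L L' : FirstOrder.Language.{0, 0}} {A : Type} {K : Type} [DecidableEq K]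
  {Γ : K → Type} {σ : Type}

/-- Programs on the work stacks and the stacks of a subroutine. -/
abbrev Prog (L L' : FirstOrder.Language.{0, 0}) (A : Type) {K : Type} (Γ : K → Type) (σ : Type) :
    Type 1 :=
  Module (Sum.elim (WkSym L L' A) Γ) σ

/-- Readers for the work stacks. -/
abbrev Readers (L L' : FirstOrder.Language.{0, 0}) (A : Type) {K : Type} (Γ : K → Type)
    (σ : Type) : Type :=
  (w : Wk) → Module.Reader (Sum.elim (WkSym L L' A) Γ) σ (.inl w)

/-- `P` turns the work stacks `s` into `s'` in at most `t` steps, the stacks of the subroutine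
being `T`. -/
def Does (T : ∀ k, List (Γ k)) (P : Prog L L' A Γ σ) (s s' : Stacks L L' A) (t : ℕ) : Prop :=
  P.Run (combine s.get T) (combine s'.get T) t

/-- Push a symbol on a work stack. -/
def put (w : Wk) (a : WkSym L L' A w) : Prog L L' A Γ σ :=
  Module.push (Γ := Sum.elim (WkSym L L' A) Γ) (.inl w) a

variable {T : ∀ k, List (Γ k)} {s s' s'' : Stacks L L' A} {t t' : ℕ}

theorem Does.mono {P : Prog L L' A Γ σ} (h : Does T P s s' t) (ht : t ≤ t') : Does T P s s' t' :=
  Module.Run.mono h ht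

theorem Does.of_eq {P : Prog L L' A Γ σ} (h : Does T P s s' t) (hs : s' = s'') (ht : t ≤ t') :
    Does T P s s'' t' :=
  hs ▸ h.mono ht

theorem Does.congr_left {P : Prog L L' A Γ σ} (h : Does T P s s' t) (hs : s = s'') :
    Does T P s'' s' t :=
  hs ▸ h

theorem Does.seq {P Q : Prog L L' A Γ σ} (h : Does T P s s' t) (h' : Does T Q s' s'' t') :
    Does T (Module.seq P Q) s s'' (t + t') :=
  Module.Run.seq h h'

theorem update_combine_get (s : Stacks L L' A) (T : ∀ k, List (Γ k)) (w : Wk)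
    (x : List (WkSym L L' A w)) :
    Function.update (combine s.get T) (.inl w) x = combine (s.upd w x).get T :=
  (update_combine_inl s.get T w x).trans (by rw [Stacks.update_get])

theorem does_skip : Does T (Module.skip : Prog L L' A Γ σ) s s 1 := Module.run_skip _

theorem does_put {w : Wk} {a : WkSym L L' A w} :
    Does T (put w a : Prog L L' A Γ σ) s (s.upd w (a :: s.get w)) 1 := by
  exact (Module.run_push (σ := σ) (Γ := Sum.elim (WkSym L L' A) Γ) (Sum.inl w) a
    (combine s.get T)).of_eq rfl (update_combine_get ..)

variable [Finite (Sym L)] [Finite (Sym L')] [Finite A] (R : Readers L L' A Γ σ)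

/-- Pop a symbol from a work stack and branch on it. -/
def take (w : Wk) (P : Option (WkSym L L' A w) → Prog L L' A Γ σ) : Prog L L' A Γ σ :=
  have : Finite (Sum.elim (WkSym L L' A) Γ (.inl w)) := WkSym.finite L L' A w
  Module.pop (R w) P

/-- Empty a work stack, running a program for each symbol. -/
def each (w : Wk) (P : WkSym L L' A w → Prog L L' A Γ σ) : Prog L L' A Γ σ :=
  have : Finite (Sum.elim (WkSym L L' A) Γ (.inl w)) := WkSym.finite L L' A w
  Module.loop (R w) P

variable {R}

theorem Does.take_nil {w : Wk} {P : Option (WkSym L L' A w) → Prog L L' A Γ σ}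
    (hs : s.get w = []) (h : Does T (P none) s s' t) : Does T (take R w P) s s' (t + 1) := by
  have hs' : s.upd w [] = s := by cases w <;> (cases s; simp only [Stacks.get] at hs; subst hs; rfl)
  have : Finite (Sum.elim (WkSym L L' A) Γ (.inl w)) := WkSym.finite L L' A w
  have h₁ : combine s.get T (Sum.inl w) = [] := hs
  refine Module.Run.pop (R w) ?_
  rw [h₁]
  exact Module.Run.of_eq h ((congrArg (fun s : Stacks L L' A => combine s.get T) hs'.symm).trans
    (update_combine_get s T w []).symm) rfl

theorem Does.take_cons {w : Wk} {P : Option (WkSym L L' A w) → Prog L L' A Γ σ}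
    {a : WkSym L L' A w} {l : List (WkSym L L' A w)}
    (hs : s.get w = a :: l) (h : Does T (P (some a)) (s.upd w l) s' t) :
    Does T (take R w P) s s' (t + 1) := by
  have : Finite (Sum.elim (WkSym L L' A) Γ (.inl w)) := WkSym.finite L L' A w
  have h₁ : combine s.get T (Sum.inl w) = a :: l := hs
  refine Module.Run.pop (R w) ?_
  rw [h₁]
  exact Module.Run.of_eq h (update_combine_get s T w l).symm rfl

/-- Running the loop over the part `l` of the stack `w` turns `s` into `s'` (where the stack `w`
itself is not taken into account) in at most `t` steps. -/
def LoopsOver (T : ∀ k, List (Γ k)) (R : Readers L L' A Γ σ) {w : Wk}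
    (P : WkSym L L' A w → Prog L L' A Γ σ) (l : List (WkSym L L' A w)) (s s' : Stacks L L' A)
    (t : ℕ) : Prop :=
  ∀ r s'' t', Does T (each R w P) (s'.upd w r) s'' t' →
    Does T (each R w P) (s.upd w (l ++ r)) s'' (t + t')

variable {w : Wk} {P : WkSym L L' A w → Prog L L' A Γ σ} {l l' : List (WkSym L L' A w)}

theorem LoopsOver.nil : LoopsOver T R P [] s s 0 := fun r s'' t' h => by simpa using h

theorem LoopsOver.mono (h : LoopsOver T R P l s s' t) (ht : t ≤ t') :
    LoopsOver T R P l s s' t' := fun r s'' t'' h' => (h r s'' t'' h').mono (by omega)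

/-- The continuation form of `LoopsOver` is made for this: the loop over `l'` serves as the
continuation of the loop over `l`, and the final emptiness test is paid only once. -/
theorem LoopsOver.append (h : LoopsOver T R P l s s' t) (h' : LoopsOver T R P l' s' s'' t') :
    LoopsOver T R P (l ++ l') s s'' (t + t') := fun r s₁ t₁ h₁ => by
  rw [List.append_assoc]
  exact (h _ _ _ (h' _ _ _ h₁)).mono (by rw [Nat.add_assoc])

theorem LoopsOver.singleton {a : WkSym L L' A w}
    (h : ∀ r, Does T (P a) (s.upd w r) (s'.upd w r) t) :
    LoopsOver T R P [a] s s' (t + 1) := fun r s₁ t₁ h₁ => by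
  have : Finite (Sum.elim (WkSym L L' A) Γ (.inl w)) := WkSym.finite L L' A w
  refine Does.mono (t := t + t₁ + 1) (Module.run_loop_cons (R w) (a := a) (l := r) ?_ ?_ h₁)
    (by omega)
  · exact Stacks.get_upd ..
  · exact Module.Run.of_eq (h r) ((congrArg (fun s : Stacks L L' A => combine s.get T)
      (Stacks.upd_upd ..).symm).trans (update_combine_get ..).symm) rfl

/-- `I d` is the loop invariant once the blocks of the prefix `d` have been consumed; one block may
span several iterations. -/
theorem LoopsOver.flatMap {α : Type} {g : α → List (WkSym L L' A w)}
    (I : List α → Stacks L L' A) (l : List α)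
    (h : ∀ d a r, d ++ a :: r = l → LoopsOver T R P (g a) (I d) (I (d ++ [a])) t) :
    LoopsOver T R P (l.flatMap g) (I []) (I l) (l.length * t) := by
  have key : ∀ r d, d ++ r = l → LoopsOver T R P (r.flatMap g) (I d) (I l) (r.length * t) := by
    intro r
    induction r with
    | nil => rintro d rfl; simpa using LoopsOver.nil
    | cons a r ih =>
      intro d hd
      rw [List.flatMap_cons]
      exact ((h d a r hd).append (ih (d ++ [a]) (by simpa using hd))).mono
        (by simp only [List.length_cons, Nat.succ_mul]; omega)
  exact key l [] rfl

theorem LoopsOver.does (h : LoopsOver T R P l s s' t) :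
    Does T (each R w P) (s.upd w l) (s'.upd w []) (t + 1) := by
  have : Finite (Sum.elim (WkSym L L' A) Γ (.inl w)) := WkSym.finite L L' A w
  have h₁ := h [] (s'.upd w []) 1 (Module.run_loop_nil (R w) P (Stacks.get_upd ..))
  simpa using h₁

/-- The invariant `I` is indexed by the symbols already popped. Its value on the stack `w` itself is
irrelevant, being overwritten everywhere. -/
theorem does_each {n : ℕ} (I : List (WkSym L L' A w) → Stacks L L' A) (hl : l.length ≤ n)
    (hs : s = (I []).upd w l) (hs' : s' = (I l).upd w [])
    (h : ∀ d a r, d ++ a :: r = l → ∀ r',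
      Does T (P a) ((I d).upd w r') ((I (d ++ [a])).upd w r') t) :
    Does T (each R w P) s s' (n * (t + 1) + 1) := by
  subst hs hs'
  have h₁ : LoopsOver T R P (l.flatMap fun a => [a]) (I []) (I l) (l.length * (t + 1)) :=
    LoopsOver.flatMap I l fun d a r hd => .singleton (h d a r hd)
  rw [List.flatMap_singleton'] at h₁
  exact h₁.does.mono (by gcongr)

end Programs

end QCSPReduction

namespace QCSPReduction

/-- Agreement of two rows can be decided entry by entry during a single walk. -/
theorem take_succ_eq_iff {A : Type} {t t' : List A} {i : ℕ} (h : i < t.length) (h' : i < t'.length) :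
    t.take (i + 1) = t'.take (i + 1) ↔ t.take i = t'.take i ∧ t[i] = t'[i] := by
  rw [List.take_succ_eq_append_getElem h, List.take_succ_eq_append_getElem h']
  constructor
  · intro e
    have := List.append_inj e (by simp [h.le, h'.le])
    simpa using this
  · rintro ⟨e₁, e₂⟩; rw [e₁, e₂]

section Programs

variable {L L' : FirstOrder.Language.{0, 0}} {A : Type} {K : Type} [DecidableEq K]
  {Γ : K → Type} {σ : Type} [Finite (Sym L)] [Finite (Sym L')] [Finite A]
  (R : Readers L L' A Γ σ) (φ : L →ᴸ L') (name : A → L'.Constants)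
  {T : ∀ k, List (Γ k)}

open List (replicate)

/-! ### Words -/

/-- The word of a variable. -/
def varWord (L : FirstOrder.Language.{0, 0}) (n : ℕ) : List (Sym L) :=
  Sym.var :: replicate n Sym.tick

/-- The atom for the variable of index `i` bound by the quantifier `q`, for a row with entry `a`
and offset `x` and a row with offset `y`. -/
def cellWord (q : Quantifier) (a : A) (x y i : ℕ) : List (Sym L') :=
  Sym.eq :: (varWord L' (x + i) ++ match q with
    | .all => [Sym.const (name a)]
    | .ex => varWord L' (y + i))

/-- The atoms for a pair of rows. -/
def pairWord [DecidableEq A] (qs : List Quantifier) (t t' : List A) (x y : ℕ) : List (Sym L') :=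
  (List.range qs.length).flatMap fun i =>
    if t.take i = t'.take i then
      match qs[i]?, t[i]? with
      | some q, some a => cellWord name q a x y i
      | _, _ => []
    else []

/-! ### Programs -/

/-- Write as many ticks as the stack `w` has symbols. -/
def emit (w : Wk) (u : WkSym L L' A w) : Prog L L' A Γ σ :=
  each R w (fun _ => (put .tk ()).seq (put .acc Sym.tick)) |>.seq <|
  each R .tk fun _ => put w u

/-- Write `cellWord`. -/
def emitCell (q : Quantifier) (a : A) : Prog L L' A Γ σ :=
  (put .acc Sym.eq).seq <| (put .acc Sym.var).seq <| (emit R .o1 ()).seq <|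
  (emit R .ix ()).seq <|
  match q with
  | .all => put .acc (Sym.const (name a))
  | .ex => (put .acc Sym.var).seq <| (emit R .o2 ()).seq <| emit R .ix ()

/-- Empty a stack. -/
def clear (w : Wk) : Prog L L' A Γ σ := each R w fun _ => Module.skip

variable {R φ name}

variable (s : Stacks L L' A) {n : ℕ}

/-- Reading a stack destroys it, so a first loop moves the counter to `tk` while writing ticks and a
second one moves it back: `(3n + 1) + (2n + 1)` steps. -/
theorem does_emit_o1 {x : ℕ} (hx : x ≤ n) :
    Does T (emit R .o1 ()) { s with o1 := replicate x (), tk := [] }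
      { s with o1 := replicate x (), tk := [], acc := replicate x Sym.tick ++ s.acc }
      (5 * n + 2) := by
  refine Does.mono (Does.seq
    (does_each (w := .o1) (l := replicate x ()) (n := n) (t := 2)
      (fun d => { s with
        tk := replicate d.length (), acc := replicate d.length Sym.tick ++ s.acc })
      (by simpa using hx) rfl rfl fun d a r _ r' => ?_)
    (does_each (w := .tk) (l := replicate x ()) (n := n) (t := 1)
      (fun d => { s with
        o1 := replicate d.length (), acc := replicate x Sym.tick ++ s.acc })
      (by simpa using hx) ?_ ?_ fun d a r _ r' => ?_)) ?_
  · exact Does.of_eq (Does.seq does_put does_put)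
      (by simp [Stacks.upd, Stacks.get, List.replicate_succ]) le_rfl
  · simp [Stacks.upd]
  · simp [Stacks.upd]
  · exact Does.of_eq does_put (by simp [Stacks.upd, Stacks.get, List.replicate_succ]) le_rfl
  · omega

theorem does_emit_o2 {x : ℕ} (hx : x ≤ n) :
    Does T (emit R .o2 ()) { s with o2 := replicate x (), tk := [] }
      { s with o2 := replicate x (), tk := [], acc := replicate x Sym.tick ++ s.acc }
      (5 * n + 2) := by
  refine Does.mono (Does.seq
    (does_each (w := .o2) (l := replicate x ()) (n := n) (t := 2)
      (fun d => { s with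
        tk := replicate d.length (), acc := replicate d.length Sym.tick ++ s.acc })
      (by simpa using hx) rfl rfl fun d a r _ r' => ?_)
    (does_each (w := .tk) (l := replicate x ()) (n := n) (t := 1)
      (fun d => { s with
        o2 := replicate d.length (), acc := replicate x Sym.tick ++ s.acc })
      (by simpa using hx) ?_ ?_ fun d a r _ r' => ?_)) ?_
  · exact Does.of_eq (Does.seq does_put does_put)
      (by simp [Stacks.upd, Stacks.get, List.replicate_succ]) le_rfl
  · simp [Stacks.upd]
  · simp [Stacks.upd]
  · exact Does.of_eq does_put (by simp [Stacks.upd, Stacks.get, List.replicate_succ]) le_rfl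
  · omega

theorem does_emit_ix {x : ℕ} (hx : x ≤ n) :
    Does T (emit R .ix ()) { s with ix := replicate x (), tk := [] }
      { s with ix := replicate x (), tk := [], acc := replicate x Sym.tick ++ s.acc }
      (5 * n + 2) := by
  refine Does.mono (Does.seq
    (does_each (w := .ix) (l := replicate x ()) (n := n) (t := 2)
      (fun d => { s with
        tk := replicate d.length (), acc := replicate d.length Sym.tick ++ s.acc })
      (by simpa using hx) rfl rfl fun d a r _ r' => ?_)
    (does_each (w := .tk) (l := replicate x ()) (n := n) (t := 1)
      (fun d => { s with
        ix := replicate d.length (), acc := replicate x Sym.tick ++ s.acc })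
      (by simpa using hx) ?_ ?_ fun d a r _ r' => ?_)) ?_
  · exact Does.of_eq (Does.seq does_put does_put)
      (by simp [Stacks.upd, Stacks.get, List.replicate_succ]) le_rfl
  · simp [Stacks.upd]
  · simp [Stacks.upd]
  · exact Does.of_eq does_put (by simp [Stacks.upd, Stacks.get, List.replicate_succ]) le_rfl
  · omega

/-- At most four counters are emitted, at `5n + 2` steps each, and three single symbols pushed. -/
theorem does_emitCell {q : Quantifier} {a : A} {x y i : ℕ} (hx : x ≤ n) (hy : y ≤ n) (hi : i ≤ n) :
    Does T (emitCell R name q a)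
      { s with o1 := replicate x (), o2 := replicate y (), ix := replicate i (), tk := [] }
      { s with
        o1 := replicate x (), o2 := replicate y (), ix := replicate i (), tk := []
        acc := (cellWord name q a x y i).reverse ++ s.acc }
      (20 * n + 11) := by
  cases q with
  | all =>
    refine Does.of_eq (Does.seq does_put <| Does.seq does_put <|
      Does.seq (does_emit_o1 { s with
        o2 := replicate y (), ix := replicate i (), acc := Sym.var :: Sym.eq :: s.acc } hx) <|
      Does.seq (does_emit_ix { s with
        o1 := replicate x (), o2 := replicate y (),
        acc := replicate x Sym.tick ++ Sym.var :: Sym.eq :: s.acc } hi) does_put) ?_ (by omega)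
    simp [-List.replicate_append_replicate, Stacks.upd, Stacks.get, cellWord, varWord, List.replicate_add]
  | ex =>
    refine Does.of_eq (Does.seq does_put <| Does.seq does_put <|
      Does.seq (does_emit_o1 { s with
        o2 := replicate y (), ix := replicate i (), acc := Sym.var :: Sym.eq :: s.acc } hx) <|
      Does.seq (does_emit_ix { s with
        o1 := replicate x (), o2 := replicate y (),
        acc := replicate x Sym.tick ++ Sym.var :: Sym.eq :: s.acc } hi) <|
      Does.seq does_put <|
      Does.seq (does_emit_o2 { s with
        o1 := replicate x (), ix := replicate i (),
        acc := Sym.var :: (replicate i Sym.tick ++ (replicate x Sym.tick ++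
          Sym.var :: Sym.eq :: s.acc)) } hy) <|
      (does_emit_ix { s with
        o1 := replicate x (), o2 := replicate y (),
        acc := replicate y Sym.tick ++ Sym.var :: (replicate i Sym.tick ++ (replicate x Sym.tick ++
          Sym.var :: Sym.eq :: s.acc)) } hi)) ?_ (by omega)
    simp [-List.replicate_append_replicate, cellWord, varWord, List.replicate_add]

theorem does_clear {w : Wk} {l : List (WkSym L L' A w)} (hl : l.length ≤ n) :
    Does T (clear R w) (s.upd w l) (s.upd w []) (2 * n + 1) :=
  (does_each (n := n) (fun _ => s) hl rfl rfl fun _ _ _ _ _ => does_skip).mono (by omega)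

variable [DecidableEq A]

variable (R name) in
/-- Process the entries `oa` and `ob` of two rows which agree so far. -/
def compareCells (q : Quantifier) : Option A → Option A → Prog L L' A Γ σ
  | some a, some b =>
    (emitCell R name q a).seq <| if a = b then Module.skip else clear R .el1
  | _, _ => Module.skip

variable (R name) in
/-- Walk along two rows. -/
def walk : Prog L L' A Γ σ :=
  each R .qs fun q => (put .qsB q).seq <|
    (take R .el2 fun ob => take R .el1 fun oa => compareCells R name q oa ob).seq <|
    put .ix ()

variable (R name) in
/-- Write `pairWord`. -/
def pairProg : Prog L L' A Γ σ :=
  (each R .elR2 fun a => put .el2 a).seq <|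
  (each R .elC fun a => put .elR a).seq <|
  (each R .elR fun a => (put .elC a).seq (put .el1 a)).seq <|
  (walk R name).seq <|
  (each R .qsB fun q => (put .qs q).seq (put .o2 ())).seq <|
  (clear R .el1).seq <| (clear R .el2).seq <| clear R .ix

/-- Emptiness of `el1` serves as the flag that the rows have already differed: at the first
difference that stack is cleared. What is finally left on it depends on the rows, hence the
existential `e`. -/
theorem does_walk {qs : List Quantifier} {t t' : List A} {x y : ℕ} (hx : x ≤ n) (hy : y ≤ n)
    (hqs : qs.length ≤ n) (ht : qs.length ≤ t.length) (ht' : qs.length ≤ t'.length)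
    (htn : t.length ≤ n) :
    ∃ e, e.length ≤ n ∧ Does T (walk R name)
      { s with
        o1 := replicate x (), o2 := replicate y (), ix := [], tk := [], qs := qs, qsB := []
        el1 := t, el2 := t' }
      { s with
        o1 := replicate x (), o2 := replicate y (), ix := replicate qs.length (), tk := []
        qs := [], qsB := qs.reverse, el1 := e, el2 := t'.drop qs.length
        acc := (pairWord name qs t t' x y).reverse ++ s.acc }
      (n * (22 * n + 18) + 1) := by
  set cell : ℕ → List (Sym L') := fun i =>
    if t.take i = t'.take i then
      match qs[i]?, t[i]? with
      | some q, some a => cellWord name q a x y i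
      | _, _ => []
    else [] with hcell
  -- Content of `el1` before position `i`: the unread part of `t` while the rows agree, nothing
  -- afterwards.
  let rest (i : ℕ) : List A := if t.take i = t'.take i then t.drop i else []
  refine ⟨rest qs.length, ?_, Does.of_eq (does_each (w := .qs) (l := qs) (n := n)
    (t := 22 * n + 17)
    (fun d => { s with
      o1 := replicate x (), o2 := replicate y (), ix := replicate d.length (), tk := []
      qsB := d.reverse, el1 := rest d.length, el2 := t'.drop d.length
      acc := ((List.range d.length).flatMap cell).reverse ++ s.acc }) hqs ?_ rfl ?_) rfl le_rfl⟩
  · simp only [rest]; split_ifs <;> simp; omega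
  · simp [Stacks.upd, rest]
  · intro d q r hd r'
    have hdq : d.length < qs.length := by simp [← hd]
    have hq : qs[d.length]? = some q := by simp [← hd]
    have h₁ : d.length < t.length := by omega
    have h₂ : d.length < t'.length := by omega
    refine Does.mono (t := 1 + ((22 * n + 14 + 1) + 1)) (Does.seq does_put (Does.seq
      (Does.take_cons (w := .el2) (a := t'[d.length]) (l := t'.drop (d.length + 1)) ?_
        (s' := { s with
          o1 := replicate x (), o2 := replicate y (), ix := replicate d.length (), tk := []
          qs := r', qsB := q :: d.reverse, el1 := rest (d.length + 1)
          el2 := t'.drop (d.length + 1)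
          acc := ((List.range (d.length + 1)).flatMap cell).reverse ++ s.acc }) ?_)
      (Does.of_eq does_put ?_ le_rfl))) (by omega)
    · simp [Stacks.upd, Stacks.get]
    · by_cases hagree : t.take d.length = t'.take d.length
      · refine Does.mono (t := 22 * n + 13 + 1)
          (Does.take_cons (w := .el1) (a := t[d.length]) (l := t.drop (d.length + 1)) ?_
            ?_) (by omega)
        · simp [Stacks.upd, Stacks.get, rest, hagree]
        · have hw : cell d.length = cellWord name q t[d.length] x y d.length := by
            simp only [hcell, hagree, hq]; simp [h₁]
          have hcellrun := does_emitCell (T := T) (R := R) (name := name) { s with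
              qs := r', qsB := q :: d.reverse, el1 := t.drop (d.length + 1)
              el2 := t'.drop (d.length + 1)
              acc := ((List.range d.length).flatMap cell).reverse ++ s.acc } (q := q)
              (a := t[d.length]) hx hy (i := d.length) (by omega : d.length ≤ n)
          refine Does.mono (Does.seq (t' := 2 * n + 1) hcellrun ?_) (by omega)
          split_ifs with hab
          · have hr : rest (d.length + 1) = t.drop (d.length + 1) := by
              simp only [rest]
              rw [if_pos ((take_succ_eq_iff h₁ h₂).2 ⟨hagree, hab⟩)]
            refine Does.of_eq does_skip ?_ (by omega)
            simp [List.range_succ, hr, hw]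
          · have hr : rest (d.length + 1) = [] := by
              simp only [rest]
              rw [if_neg fun h => hab ((take_succ_eq_iff h₁ h₂).1 h).2]
            refine Does.of_eq (does_clear { s with
              o1 := replicate x (), o2 := replicate y (), ix := replicate d.length (), tk := []
              qs := r', qsB := q :: d.reverse
              el2 := t'.drop (d.length + 1)
              acc := (cellWord name q t[d.length] x y d.length).reverse ++
                (((List.range d.length).flatMap cell).reverse ++ s.acc) } (w := .el1)
              (l := t.drop (d.length + 1)) (n := n) (by simp; omega)) ?_ (by omega)
            simp [Stacks.upd, List.range_succ, hr, hw]
      -- The rows differed earlier: `el1` is empty, `none` is read and no atom is written.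
      · refine Does.mono (t := 1 + 1)
          (Does.take_nil (w := .el1) ?_ ?_) (by omega)
        · simp [Stacks.upd, Stacks.get, rest, hagree]
        · have hr : rest (d.length + 1) = [] := by
            simp only [rest]
            rw [if_neg fun h => hagree ((take_succ_eq_iff h₁ h₂).1 h).1]
          have hr' : rest d.length = [] := by simp only [rest]; rw [if_neg hagree]
          have hw : cell d.length = [] := by simp only [hcell, hagree]; rfl
          refine Does.of_eq does_skip ?_ le_rfl
          simp [Stacks.upd, Stacks.get, List.range_succ, hr, hr', hw]
    · simp [Stacks.upd, Stacks.get, List.replicate_succ]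

/-- The first row stays available on `elC`, and `o2` advances by one block of variables, ready for
the next second row. -/
theorem does_pairProg {qs : List Quantifier} {t t' : List A} {x y : ℕ} (hx : x ≤ n) (hy : y ≤ n)
    (hqs : qs.length ≤ n) (ht : qs.length ≤ t.length) (ht' : qs.length ≤ t'.length)
    (htn : t.length ≤ n) (htn' : t'.length ≤ n) :
    Does T (pairProg R name)
      { s with
        o1 := replicate x (), o2 := replicate y (), ix := [], tk := [], qs := qs, qsB := []
        elC := t, elR := [], el1 := [], elR2 := t'.reverse, el2 := [] }
      { s with
        o1 := replicate x (), o2 := replicate (y + qs.length) (), ix := [], tk := []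
        qs := qs, qsB := [], elC := t, elR := [], el1 := [], elR2 := [], el2 := []
        acc := (pairWord name qs t t' x y).reverse ++ s.acc }
      (n * (22 * n + 18) + 16 * n + 20) := by
  obtain ⟨e, he, hwalk⟩ := does_walk (T := T) (R := R) (name := name)
    { s with elC := t, elR := [], elR2 := [] } hx hy hqs ht ht' htn
  refine Does.mono (Does.seq
    (does_each (w := .elR2) (l := t'.reverse) (n := n) (t := 1)
      (fun d => { s with
        o1 := replicate x (), o2 := replicate y (), ix := [], tk := [], qs := qs, qsB := []
        elC := t, elR := [], el1 := [], el2 := d.reverse })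
      (by simpa using htn') rfl rfl fun d a r _ r' => ?_) <| Does.seq
    (does_each (w := .elC) (l := t) (n := n) (t := 1)
      (fun d => { s with
        o1 := replicate x (), o2 := replicate y (), ix := [], tk := [], qs := qs, qsB := []
        elR := d.reverse, el1 := [], elR2 := [], el2 := t' })
      htn ?_ rfl fun d a r _ r' => ?_) <| Does.seq
    (does_each (w := .elR) (l := t.reverse) (n := n) (t := 2)
      (fun d => { s with
        o1 := replicate x (), o2 := replicate y (), ix := [], tk := [], qs := qs, qsB := []
        elC := d.reverse, el1 := d.reverse, elR2 := [], el2 := t' })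
      (by simpa using htn) rfl ?_ fun d a r _ r' => ?_) <|
    Does.seq hwalk <| Does.seq
    (does_each (w := .qsB) (l := qs.reverse) (n := n) (t := 2)
      (fun d => { s with
        o1 := replicate x (), o2 := replicate (y + d.length) (), ix := replicate qs.length ()
        tk := [], qs := d.reverse, elC := t, elR := [], el1 := e, elR2 := []
        el2 := t'.drop qs.length
        acc := (pairWord name qs t t' x y).reverse ++ s.acc })
      (s' := { s with
        o1 := replicate x (), o2 := replicate (y + qs.length) (), ix := replicate qs.length ()
        tk := [], qs := qs, qsB := [], elC := t, elR := [], el1 := e, elR2 := []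
        el2 := t'.drop qs.length
        acc := (pairWord name qs t t' x y).reverse ++ s.acc })
      (by simpa using hqs) rfl ?_ fun d a r _ r' => ?_) <|
    Does.seq
      (does_clear { s with
        o1 := replicate x (), o2 := replicate (y + qs.length) (), ix := replicate qs.length ()
        tk := [], qs := qs, qsB := [], elC := t, elR := [], el1 := e, elR2 := []
        el2 := t'.drop qs.length
        acc := (pairWord name qs t t' x y).reverse ++ s.acc } (w := .el1) (l := e) he) <|
    Does.seq
      (does_clear { s with
        o1 := replicate x (), o2 := replicate (y + qs.length) (), ix := replicate qs.length ()
        tk := [], qs := qs, qsB := [], elC := t, elR := [], el1 := [], elR2 := []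
        acc := (pairWord name qs t t' x y).reverse ++ s.acc } (w := .el2)
        (l := t'.drop qs.length) (n := n) (by simp; omega))
      (does_clear { s with
        o1 := replicate x (), o2 := replicate (y + qs.length) ()
        tk := [], qs := qs, qsB := [], elC := t, elR := [], el1 := [], elR2 := [], el2 := []
        acc := (pairWord name qs t t' x y).reverse ++ s.acc } (w := .ix)
        (l := replicate qs.length ()) (n := n) (by simpa using hqs))) ?_
  all_goals first
    | exact Does.of_eq does_put (by simp [Stacks.upd, Stacks.get]) le_rfl
    | exact Does.of_eq (Does.seq does_put does_put)
        (by simp [Stacks.upd, Stacks.get, ← Nat.add_assoc, List.replicate_succ]) le_rfl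
    | omega
    | simp [Stacks.upd]


end Programs

end QCSPReduction

namespace QCSPReduction

/-! ### Writing the atoms for all rows, reading the input, final clean-up -/

section Programs

variable {L L' : FirstOrder.Language.{0, 0}} {A : Type} {K : Type} [DecidableEq K]
  {Γ : K → Type} {σ : Type} [Finite (Sym L)] [Finite (Sym L')] [Finite A]
  (R : Readers L L' A Γ σ) (φ : L →ᴸ L') (name : A → L'.Constants)
  {T : ∀ k, List (Γ k)}

open List (replicate)

theorem LoopsOver.map {w : Wk} {P : WkSym L L' A w → Prog L L' A Γ σ} {t : ℕ} {α : Type}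
    {R : Readers L L' A Γ σ} (g : α → WkSym L L' A w) (I : List α → Stacks L L' A) (l : List α)
    (h : ∀ d, ∀ a ∈ l, ∀ r, Does T (P (g a)) ((I d).upd w r) ((I (d ++ [a])).upd w r) t) :
    LoopsOver T R P (l.map g) (I []) (I l) (l.length * (t + 1)) := by
  rw [List.map_eq_flatMap]
  exact LoopsOver.flatMap I l fun d a r hd => .singleton (h d a (by simp [← hd]))

/-- Transfer a symbol to another language. -/
def mapSym : Sym L → Sym L'
  | .quant q => .quant q
  | .rel k r => .rel k (φ.onRelation r)
  | .eq => .eq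
  | .const c => .const (φ.onFunction c)
  | .var => .var
  | .tick => .tick

/-- Add `x` to the indices of the variables. -/
def shiftWord (x : ℕ) (w : List (Sym L)) : List (Sym L') :=
  w.flatMap fun
    | .var => varWord L' x
    | c => [mapSym φ c]

/-- The word of a row. -/
def rowWord (t : List A) : List (Option A) := t.map some ++ [none]

/-- The atoms of the output belonging to a row. -/
def rowAtomsWord [DecidableEq A] (qs : List Quantifier) (mat : List (Sym L)) (rs : List (List A)) (t : List A)
    (x : ℕ) : List (Sym L') :=
  shiftWord φ x mat ++
    rs.zipIdx.flatMap fun p => pairWord name qs t p.1 x (p.2 * qs.length)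

/-- The atoms of the output. -/
def atomsWord [DecidableEq A] (qs : List Quantifier) (mat : List (Sym L)) (rs : List (List A)) : List (Sym L') :=
  rs.zipIdx.flatMap fun p => rowAtomsWord φ name qs mat rs p.1 (p.2 * qs.length)



/-- Write the quantifier-free part for one row. -/
def emitMat : Prog L L' A Γ σ :=
  (each R .mat fun c => (put .matB c).seq <| (put .acc (mapSym φ c)).seq <|
    match c with
    | .var => emit R .o1 ()
    | _ => Module.skip).seq <|
  each R .matB fun c => put .mat c

/-- Write the quantifiers and clean up. -/
def finish : Prog L L' A Γ σ :=
  (each R .acc fun c => put .outp c).seq <|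
  (each R .o1 fun _ => put .outp (Sym.quant .ex)).seq <|
  (clear R .qs).seq <| (clear R .mat).seq <| clear R .rowsC

/-- Read a symbol of the input. -/
def loadBody : Sym L → Prog L L' A Γ σ
  | .quant q => (put .qsB q).seq (put .ix ())
  | c => put .matB c

/-- Read the input. -/
def load : Prog L L' A Γ σ :=
  (each R .inp loadBody).seq <|
  (put .ix ()).seq <| (each R .qsB fun q => put .qs q).seq <| each R .matB fun c => put .mat c

variable {R φ name} (s : Stacks L L' A) {n : ℕ}

/-- As indices are unary, adding `x` to them means inserting `x` ticks after each `var`; every other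
symbol is transferred one by one. -/
theorem does_emitMat {x : ℕ} {w : List (Sym L)} (hx : x ≤ n) (hw : w.length ≤ n) :
    Does T (emitMat R φ) { s with o1 := replicate x (), tk := [], mat := w, matB := [] }
      { s with
        o1 := replicate x (), tk := [], mat := w, matB := []
        acc := (shiftWord φ x w).reverse ++ s.acc }
      (n * (5 * n + 5) + 2 * n + 2) := by
  refine Does.mono (Does.seq
    (does_each (w := .mat) (l := w) (n := n) (t := 5 * n + 4)
      (fun d => { s with
        o1 := replicate x (), tk := [], matB := d.reverse
        acc := (shiftWord φ x d).reverse ++ s.acc })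
      hw rfl rfl fun d a r _ r' => ?_)
    (does_each (w := .matB) (l := w.reverse) (n := n) (t := 1)
      (fun d => { s with
        o1 := replicate x (), tk := [], mat := d.reverse
        acc := (shiftWord φ x w).reverse ++ s.acc })
      (by simpa using hw) rfl (by simp [Stacks.upd])
      fun d a r _ r' => Does.of_eq does_put (by simp [Stacks.upd, Stacks.get]) le_rfl)) (by linarith)
  have hskip : ∀ c : Sym L, shiftWord φ x [c] = [mapSym φ c] →
      Does T ((put .matB c).seq <| (put .acc (mapSym φ c)).seq Module.skip : Prog L L' A Γ σ)
        { s with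
          o1 := replicate x (), tk := [], matB := d.reverse, mat := r'
          acc := (shiftWord φ x d).reverse ++ s.acc }
        { s with
          o1 := replicate x (), tk := [], matB := (d ++ [c]).reverse, mat := r'
          acc := (shiftWord φ x (d ++ [c])).reverse ++ s.acc } (5 * n + 4) := fun c hc => by
    refine Does.of_eq (Does.seq does_put (Does.seq does_put does_skip)) ?_ (by omega)
    have : shiftWord φ x (d ++ [c]) = shiftWord φ x d ++ shiftWord φ x [c] := by
      simp [shiftWord]
    simp [Stacks.upd, Stacks.get, this, hc]
  cases a with
  | var =>
    refine Does.of_eq (Does.seq does_put (Does.seq does_put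
      (does_emit_o1 { s with
        matB := Sym.var :: d.reverse, mat := r'
        acc := Sym.var :: ((shiftWord φ x d).reverse ++ s.acc) } hx))) ?_ (by omega)
    simp [Stacks.upd, shiftWord, varWord]
  | quant q => exact hskip _ rfl
  | rel k p => exact hskip _ rfl
  | eq => exact hskip _ rfl
  | const c => exact hskip _ rfl
  | tick => exact hskip _ rfl

/-- The output was collected in reverse on `acc`. Quantifiers are pushed last, so they come first;
by then `o1` has advanced one block per row and counts all the variables. -/
theorem does_finish {qs : List Quantifier} {rw : List (Option A)} {x n' : ℕ}
    {w : List (Sym L)} {u : List (Sym L')} (hw : w.length ≤ n) (hqs : qs.length ≤ n)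
    (hn : rw.length ≤ n) (hx : x ≤ n) (hu : u.length ≤ n') :
    Does T (finish R)
      { s with
        acc := u.reverse, o1 := replicate x (), qs := qs, rowsC := rw, mat := w, outp := [] }
      { s with
        acc := [], o1 := [], qs := [], rowsC := [], mat := []
        outp := replicate x (Sym.quant .ex) ++ u }
      (2 * n' + 8 * n + 5) := by
  refine Does.mono (Does.seq
    (does_each (w := .acc) (l := u.reverse) (n := n') (t := 1)
      (fun d => { s with
        o1 := replicate x (), qs := qs, rowsC := rw, mat := w, outp := d.reverse })
      (by simpa using hu) rfl rfl
      fun d a r _ r' => Does.of_eq does_put (by simp [Stacks.upd, Stacks.get]) le_rfl) <|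
    Does.seq
    (does_each (w := .o1) (l := replicate x ()) (n := n) (t := 1)
      (fun d => { s with
        acc := [], qs := qs, rowsC := rw, mat := w
        outp := replicate d.length (Sym.quant .ex) ++ u })
      (s' := { s with
        acc := [], o1 := [], qs := qs, rowsC := rw, mat := w
        outp := replicate x (Sym.quant .ex) ++ u })
      (by simpa using hx) (by simp [Stacks.upd]) (by simp [Stacks.upd])
      fun d a r _ r' => Does.of_eq does_put
        (by simp [Stacks.upd, Stacks.get, List.replicate_succ]) le_rfl) <|
    Does.seq (does_clear { s with
        acc := [], o1 := [], rowsC := rw, mat := w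
        outp := replicate x (Sym.quant .ex) ++ u } (w := .qs) (l := qs) hqs) <|
    Does.seq (does_clear { s with
        acc := [], o1 := [], qs := [], rowsC := rw
        outp := replicate x (Sym.quant .ex) ++ u } (w := .mat) (l := w) hw)
      (does_clear { s with
        acc := [], o1 := [], qs := [], mat := []
        outp := replicate x (Sym.quant .ex) ++ u } (w := .rowsC) (l := rw) hn)) (by omega)

/-- `ix` receives the enumerator's argument `N + 1`. Both parts of the input pass through a buffer
so as to keep their order. -/
theorem does_load {qs : List Quantifier} {w : List (Sym L)} (hw : ∀ q, Sym.quant q ∉ w)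
    (hn : w.length + qs.length ≤ n) :
    Does T (load R)
      { s with inp := qs.map Sym.quant ++ w, qs := [], qsB := [], mat := [], matB := [], ix := [] }
      { s with
        inp := [], qs := qs, qsB := [], mat := w, matB := [], ix := replicate (qs.length + 1) () }
      (7 * n + 5) := by
  have h₁ : LoopsOver T R (w := .inp) loadBody (qs.map Sym.quant)
      { s with qs := [], qsB := [], mat := [], matB := [], ix := [] }
      { s with
        qs := [], qsB := qs.reverse, mat := [], matB := [], ix := replicate qs.length () } _ :=
    LoopsOver.map (w := .inp) (t := 2) Sym.quant (fun d => { s with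
        qs := [], qsB := d.reverse, mat := [], matB := [], ix := replicate d.length () }) qs
      fun d a _ r' => Does.of_eq (Does.seq does_put does_put)
        (by simp [Stacks.upd, Stacks.get, List.replicate_succ]) le_rfl
  have h₂ : LoopsOver T R (w := .inp) loadBody (w.map id)
      { s with
        qs := [], qsB := qs.reverse, mat := [], matB := [], ix := replicate qs.length () }
      { s with
        qs := [], qsB := qs.reverse, mat := [], matB := w.reverse
        ix := replicate qs.length () } _ :=
    LoopsOver.map (w := .inp) (t := 1) id (fun d => { s with
        qs := [], qsB := qs.reverse, mat := [], matB := d.reverse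
        ix := replicate qs.length () }) w
      fun d a ha r' => by
        have hput : Does T (put .matB a : Prog L L' A Γ σ) { s with
            inp := r', qs := [], qsB := qs.reverse, mat := [], matB := d.reverse
            ix := replicate qs.length () } { s with
            inp := r', qs := [], qsB := qs.reverse, mat := [], matB := (d ++ [a]).reverse
            ix := replicate qs.length () } 1 :=
          Does.of_eq does_put (by simp [Stacks.upd, Stacks.get]) le_rfl
        cases a with
        | quant q => exact absurd ha (hw q)
        | rel k r => exact hput
        | eq => exact hput
        | const c => exact hput
        | var => exact hput
        | tick => exact hput
  rw [List.map_id] at h₂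
  refine Does.mono (Does.seq (h₁.append h₂).does <| Does.seq does_put <| Does.seq
    (does_each (w := .qsB) (l := qs.reverse) (n := n) (t := 1)
      (fun d => { s with
        inp := [], qs := d.reverse, mat := [], matB := w.reverse
        ix := replicate (qs.length + 1) () })
      (by simp; omega) rfl rfl
      fun d a r _ r' => Does.of_eq does_put (by simp [Stacks.upd, Stacks.get]) le_rfl)
    (does_each (w := .matB) (l := w.reverse) (n := n) (t := 1)
      (fun d => { s with
        inp := [], qs := qs, qsB := [], mat := d.reverse, ix := replicate (qs.length + 1) () })
      (by simp; omega) (by simp [Stacks.upd]) (by simp [Stacks.upd])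
      fun d a r _ r' => Does.of_eq does_put (by simp [Stacks.upd, Stacks.get]) le_rfl)) (by omega)

variable [DecidableEq A]

variable (R φ name)

/-- Read a symbol of the second row, and process the row at its end. -/
def pairsBody (o : Option A) : Prog L L' A Γ σ :=
  (put .rowsB o).seq <|
    match o with
    | some b => put .elR2 b
    | none => pairProg R name

/-- Write the atoms for all the pairs with a given first row. -/
def pairsProg : Prog L L' A Γ σ :=
  (each R .rowsC (pairsBody R name)).seq <|
  each R .rowsB fun o => put .rowsC o

/-- Write all the atoms of a row. -/
def rowProg : Prog L L' A Γ σ :=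
  (each R .elR fun a => put .elC a).seq <| (emitMat R φ).seq <| (pairsProg R name).seq <|
  (clear R .elC).seq <| (clear R .o2).seq <|
  (each R .qs fun q => (put .qsB q).seq (put .o1 ())).seq <|
  each R .qsB fun q => put .qs q

/-- Read a symbol of the first row, and process the row at its end. -/
def rowsBody : Option A → Prog L L' A Γ σ
  | some a => put .elR a
  | none => rowProg R φ name

/-- Write all the atoms. -/
def rowsProg : Prog L L' A Γ σ := each R .rows (rowsBody R φ name)

variable {R φ name}

/-- `rowsC` is saved on `rowsB` while being read and then restored, since it is needed again for
every first row. -/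
theorem does_pairsProg {qs : List Quantifier} {rs : List (List A)} {t : List A} {x : ℕ}
    (hx : x ≤ n) (hqs : qs.length ≤ n) (ht : qs.length ≤ t.length) (htn : t.length ≤ n)
    (hrs : ∀ t' ∈ rs, qs.length ≤ t'.length ∧ t'.length ≤ n)
    (hn : (rs.flatMap rowWord).length ≤ n) (hn' : rs.length ≤ n) (hy : rs.length * qs.length ≤ n) :
    Does T (pairsProg R name)
      { s with
        o1 := replicate x (), o2 := [], ix := [], tk := [], qs := qs, qsB := []
        elC := t, elR := [], el1 := [], elR2 := [], el2 := []
        rowsC := rs.flatMap rowWord, rowsB := [] }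
      { s with
        o1 := replicate x (), o2 := replicate (rs.length * qs.length) (), ix := [], tk := []
        qs := qs, qsB := [], elC := t, elR := [], el1 := [], elR2 := [], el2 := []
        rowsC := rs.flatMap rowWord, rowsB := []
        acc := (rs.zipIdx.flatMap fun p =>
          pairWord name qs t p.1 x (p.2 * qs.length)).reverse ++ s.acc }
      (n * (n * (22 * n + 18) + 19 * n + 22) + 2 * n + 2) := by
  have hloop := LoopsOver.flatMap (w := .rowsC) (T := T) (R := R) (g := rowWord)
    (P := pairsBody R name)
    (fun d => { s with
        o1 := replicate x (), o2 := replicate (d.length * qs.length) (), ix := [], tk := []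
        qs := qs, qsB := [], elC := t, elR := [], el1 := [], elR2 := [], el2 := []
        rowsB := (d.flatMap rowWord).reverse
        acc := (d.zipIdx.flatMap fun p =>
          pairWord name qs t p.1 x (p.2 * qs.length)).reverse ++ s.acc }) rs
    (t := n * (22 * n + 18) + 19 * n + 22) fun d t' r hd => by
      have ht' := hrs t' (by simp [← hd])
      have hd' : d.length * qs.length ≤ n :=
        (Nat.mul_le_mul_right _ (by simp [← hd])).trans hy
      refine LoopsOver.mono (LoopsOver.append
        (LoopsOver.map (w := .rowsC) (P := pairsBody R name) (t := 2) (some : A → Option A) (fun e => { s with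
          o1 := replicate x (), o2 := replicate (d.length * qs.length) (), ix := [], tk := []
          qs := qs, qsB := [], elC := t, elR := [], el1 := [], elR2 := e.reverse, el2 := []
          rowsB := (e.map some).reverse ++ (d.flatMap rowWord).reverse
          acc := (d.zipIdx.flatMap fun p =>
            pairWord name qs t p.1 x (p.2 * qs.length)).reverse ++ s.acc }) t'
          fun e a _ r' => ?_)
        (LoopsOver.singleton (t := n * (22 * n + 18) + 16 * n + 21) fun r' => ?_))
        (t := t'.length * 3 + (n * (22 * n + 18) + 16 * n + 22)) ?_
      · exact Does.of_eq (Does.seq does_put does_put) (by simp [Stacks.upd, Stacks.get]) le_rfl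
      · refine Does.of_eq (Does.seq does_put
          (does_pairProg { s with
            rowsC := r', rowsB := none :: ((t'.map some).reverse ++ (d.flatMap rowWord).reverse)
            acc := (d.zipIdx.flatMap fun p =>
              pairWord name qs t p.1 x (p.2 * qs.length)).reverse ++ s.acc }
            hx hd' hqs ht ht'.1 htn ht'.2)) ?_ (by omega)
        simp [Stacks.upd, rowWord, List.zipIdx_append, Nat.succ_mul]
      · omega
  refine Does.mono (Does.seq ((hloop.does.congr_left (by simp [Stacks.upd])).mono
    (Nat.add_le_add_right (Nat.mul_le_mul_right _ hn') 1))
    (does_each (w := .rowsB) (l := (rs.flatMap rowWord).reverse) (n := n) (t := 1)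
      (fun d => { s with
        o1 := replicate x (), o2 := replicate (rs.length * qs.length) (), ix := [], tk := []
        qs := qs, qsB := [], elC := t, elR := [], el1 := [], elR2 := [], el2 := []
        rowsC := d.reverse
        acc := (rs.zipIdx.flatMap fun p =>
          pairWord name qs t p.1 x (p.2 * qs.length)).reverse ++ s.acc })
      (by simpa using hn) rfl (by simp [Stacks.upd])
      fun d a r _ r' => Does.of_eq does_put (by simp [Stacks.upd, Stacks.get]) le_rfl)) (by linarith)

/-- The last two loops use a round trip of `qs` to advance the offset `o1` by one block of
variables. -/
theorem does_rowProg {qs : List Quantifier} {rs : List (List A)} {t : List A} {x : ℕ}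
    {w : List (Sym L)} (hw : w.length ≤ n)
    (hx : x ≤ n) (hqs : qs.length ≤ n) (ht : qs.length ≤ t.length) (htn : t.length ≤ n)
    (hrs : ∀ t' ∈ rs, qs.length ≤ t'.length ∧ t'.length ≤ n)
    (hn : (rs.flatMap rowWord).length ≤ n) (hn' : rs.length ≤ n) (hy : rs.length * qs.length ≤ n) :
    Does T (rowProg R φ name)
      { s with
        o1 := replicate x (), o2 := [], ix := [], tk := [], qs := qs, qsB := []
        elC := [], elR := t.reverse, el1 := [], elR2 := [], el2 := []
        rowsC := rs.flatMap rowWord, rowsB := [], mat := w, matB := [] }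
      { s with
        o1 := replicate (x + qs.length) (), o2 := [], ix := [], tk := []
        qs := qs, qsB := [], elC := [], elR := [], el1 := [], elR2 := [], el2 := []
        rowsC := rs.flatMap rowWord, rowsB := [], mat := w, matB := []
        acc := (rowAtomsWord φ name qs w rs t x).reverse ++ s.acc }
      (n * (n * (22 * n + 18) + 19 * n + 22) + n * (5 * n + 5) + 15 * n + 20) := by
  refine Does.mono (Does.seq
    (does_each (w := .elR) (l := t.reverse) (n := n) (t := 1)
      (fun d => { s with
        o1 := replicate x (), o2 := [], ix := [], tk := [], qs := qs, qsB := []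
        elC := d.reverse, el1 := [], elR2 := [], el2 := []
        rowsC := rs.flatMap rowWord, rowsB := [], mat := w, matB := [] })
      (s' := { s with
        o1 := replicate x (), o2 := [], ix := [], tk := [], qs := qs, qsB := []
        elC := t, elR := [], el1 := [], elR2 := [], el2 := []
        rowsC := rs.flatMap rowWord, rowsB := [], mat := w, matB := [] })
      (by simpa using htn) rfl (by simp [Stacks.upd])
      fun d a r _ r' => Does.of_eq does_put (by simp [Stacks.upd, Stacks.get]) le_rfl) <|
    Does.seq (does_emitMat { s with
        o2 := [], ix := [], qs := qs, qsB := []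
        elC := t, elR := [], el1 := [], elR2 := [], el2 := []
        rowsC := rs.flatMap rowWord, rowsB := [] } hx hw) <|
    Does.seq (does_pairsProg { s with
        mat := w, matB := [], acc := (shiftWord φ x w).reverse ++ s.acc }
        hx hqs ht htn hrs hn hn' hy) <|
    Does.seq (does_clear { s with
        o1 := replicate x (), o2 := replicate (rs.length * qs.length) (), ix := [], tk := []
        qs := qs, qsB := [], elR := [], el1 := [], elR2 := [], el2 := []
        rowsC := rs.flatMap rowWord, rowsB := [], mat := w, matB := []
        acc := (rs.zipIdx.flatMap fun p => pairWord name qs t p.1 x (p.2 * qs.length)).reverse ++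
          ((shiftWord φ x w).reverse ++ s.acc) } (w := .elC) (l := t) htn) <|
    Does.seq (does_clear { s with
        o1 := replicate x (), ix := [], tk := []
        qs := qs, qsB := [], elC := [], elR := [], el1 := [], elR2 := [], el2 := []
        rowsC := rs.flatMap rowWord, rowsB := [], mat := w, matB := []
        acc := (rs.zipIdx.flatMap fun p => pairWord name qs t p.1 x (p.2 * qs.length)).reverse ++
          ((shiftWord φ x w).reverse ++ s.acc) } (w := .o2)
          (l := replicate (rs.length * qs.length) ()) (n := n) (by simpa using hy)) <|
    Does.seq
    (does_each (w := .qs) (l := qs) (n := n) (t := 2)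
      (fun d => { s with
        o1 := replicate (x + d.length) (), o2 := [], ix := [], tk := []
        qsB := d.reverse, elC := [], elR := [], el1 := [], elR2 := [], el2 := []
        rowsC := rs.flatMap rowWord, rowsB := [], mat := w, matB := []
        acc := (rs.zipIdx.flatMap fun p => pairWord name qs t p.1 x (p.2 * qs.length)).reverse ++
          ((shiftWord φ x w).reverse ++ s.acc) })
      hqs rfl rfl
      fun d a r _ r' => Does.of_eq (Does.seq does_put does_put)
        (by simp [Stacks.upd, Stacks.get, ← Nat.add_assoc, List.replicate_succ]) le_rfl)
    (does_each (w := .qsB) (l := qs.reverse) (n := n) (t := 1)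
      (fun d => { s with
        o1 := replicate (x + qs.length) (), o2 := [], ix := [], tk := []
        qs := d.reverse, elC := [], elR := [], el1 := [], elR2 := [], el2 := []
        rowsC := rs.flatMap rowWord, rowsB := [], mat := w, matB := []
        acc := (rs.zipIdx.flatMap fun p => pairWord name qs t p.1 x (p.2 * qs.length)).reverse ++
          ((shiftWord φ x w).reverse ++ s.acc) })
      (by simpa using hqs) rfl (by simp [Stacks.upd, rowAtomsWord])
      fun d a r _ r' => Does.of_eq does_put (by simp [Stacks.upd, Stacks.get]) le_rfl))
    (by omega)

theorem does_rowsProg {qs : List Quantifier} {rs : List (List A)}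
    {w : List (Sym L)} (hw : w.length ≤ n) (hqs : qs.length ≤ n)
    (hrs : ∀ t' ∈ rs, qs.length ≤ t'.length ∧ t'.length ≤ n)
    (hn : (rs.flatMap rowWord).length ≤ n) (hn' : rs.length ≤ n) (hy : rs.length * qs.length ≤ n) :
    Does T (rowsProg R φ name)
      { s with
        o1 := [], o2 := [], ix := [], tk := [], qs := qs, qsB := []
        elC := [], elR := [], el1 := [], elR2 := [], el2 := [], rows := rs.flatMap rowWord
        rowsC := rs.flatMap rowWord, rowsB := [], mat := w, matB := [] }
      { s with
        o1 := replicate (rs.length * qs.length) (), o2 := [], ix := [], tk := []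
        qs := qs, qsB := [], elC := [], elR := [], el1 := [], elR2 := [], el2 := [], rows := []
        rowsC := rs.flatMap rowWord, rowsB := [], mat := w, matB := []
        acc := (atomsWord φ name qs w rs).reverse ++ s.acc }
      (n * (n * (n * (22 * n + 18) + 19 * n + 22) + n * (5 * n + 5) + 17 * n + 21) + 1) := by
  have hloop := LoopsOver.flatMap (w := .rows) (T := T) (R := R) (g := rowWord)
    (P := rowsBody R φ name)
    (fun d => { s with
        o1 := replicate (d.length * qs.length) (), o2 := [], ix := [], tk := []
        qs := qs, qsB := [], elC := [], elR := [], el1 := [], elR2 := [], el2 := []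
        rowsC := rs.flatMap rowWord, rowsB := [], mat := w, matB := []
        acc := (d.zipIdx.flatMap fun p =>
          rowAtomsWord φ name qs w rs p.1 (p.2 * qs.length)).reverse ++ s.acc }) rs
    (t := n * (n * (22 * n + 18) + 19 * n + 22) + n * (5 * n + 5) + 17 * n + 21)
    fun d t r hd => by
      have ht := hrs t (by simp [← hd])
      have hd' : d.length * qs.length ≤ n :=
        (Nat.mul_le_mul_right _ (by simp [← hd])).trans hy
      refine LoopsOver.mono (LoopsOver.append
        (LoopsOver.map (w := .rows) (P := rowsBody R φ name) (t := 1) (some : A → Option A) (fun e => { s with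
          o1 := replicate (d.length * qs.length) (), o2 := [], ix := [], tk := []
          qs := qs, qsB := [], elC := [], elR := e.reverse, el1 := [], elR2 := [], el2 := []
          rowsC := rs.flatMap rowWord, rowsB := [], mat := w, matB := []
          acc := (d.zipIdx.flatMap fun p =>
            rowAtomsWord φ name qs w rs p.1 (p.2 * qs.length)).reverse ++ s.acc }) t
          fun e a _ r' => ?_)
        (LoopsOver.singleton (t := n * (n * (22 * n + 18) + 19 * n + 22) + n * (5 * n + 5) +
          15 * n + 20) fun r' => ?_))
        (t := t.length * 2 + (n * (n * (22 * n + 18) + 19 * n + 22) + n * (5 * n + 5) +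
          15 * n + 21)) ?_
      · exact Does.of_eq does_put (by simp [Stacks.upd, Stacks.get]) le_rfl
      · refine Does.of_eq (does_rowProg { s with
            rows := r'
            acc := (d.zipIdx.flatMap fun p =>
              rowAtomsWord φ name qs w rs p.1 (p.2 * qs.length)).reverse ++ s.acc }
            hw hd' hqs ht.1 ht.2 hrs hn hn' hy) ?_ (by omega)
        simp [Stacks.upd, List.zipIdx_append, Nat.succ_mul]
      · omega
  exact Does.of_eq ((hloop.does.congr_left (by simp [Stacks.upd])).mono
    (Nat.add_le_add_right (Nat.mul_le_mul_right _ hn') 1))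
    (by simp [Stacks.upd, atomsWord]) le_rfl

end Programs

end QCSPReduction

namespace QCSPReduction

open List (replicate)

/-! ### Exchanging data with the enumerator -/

section Transfer

variable {L L' : FirstOrder.Language.{0, 0}} {A : Type} {K : Type} [DecidableEq K]
  {Γ : K → Type} {σ : Type} [Finite (Sym L)] [Finite (Sym L')] [Finite A]
  (R : Readers L L' A Γ σ)

/-- Copy the counter `ix` to a stack of the subroutine. -/
def transferIn (k : K) (u : Γ k) : Prog L L' A Γ σ :=
  each R .ix fun _ => Module.push (Γ := Sum.elim (WkSym L L' A) Γ) (.inr k) u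

/-- Copy a stack of the subroutine to the work stack `raw`, recoding the symbols by `g`. -/
def transferOut {k : K} [Finite (Γ k)]
    (R' : Module.Reader (Sum.elim (WkSym L L' A) Γ) σ (.inr k)) (g : Γ k → Option (Option A)) :
    Prog L L' A Γ σ :=
  have : Finite (Sum.elim (WkSym L L' A) Γ (.inr k)) := ‹Finite (Γ k)›
  Module.loop R' fun x =>
    match g x with
    | some o => put .raw o
    | none => Module.skip

variable {R} (s : Stacks L L' A)

theorem run_transferIn (T : ∀ k, List (Γ k)) (k : K) (u : Γ k) (m : ℕ) :
    (transferIn R k u).Run (combine { s with ix := replicate m () }.get T)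
      (combine { s with ix := [] }.get (Function.update T k (replicate m u ++ T k)))
      (2 * m + 1) := by
  have : Finite (Sum.elim (WkSym L L' A) Γ (.inl .ix)) := WkSym.finite L L' A .ix
  induction m generalizing T with
  | zero =>
    refine (Module.run_loop_nil (R .ix) _ ?_).of_eq rfl ?_
    · rfl
    · simp
  | succ m ih =>
    refine (Module.run_loop_cons (R .ix) (a := ()) (l := replicate m ()) (t := 1) (t' := 2 * m + 1)
      (S' := combine { s with ix := replicate m () }.get (Function.update T k (u :: T k))) ?_ ?_
      ((ih _).of_eq rfl ?_)).mono (by omega)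
    · rfl
    · refine (Module.run_push _ _ _).of_eq rfl ?_
      exact (congrArg (fun S => Function.update S (Sum.inr k) _)
        (update_combine_get { s with ix := replicate (m + 1) () } T .ix (replicate m ()))).trans
        (update_combine_inr ..)
    · simp [List.replicate_succ']

omit [Finite (Sym L)] [Finite (Sym L')] [Finite A] in
-- The word arrives on `raw` in reverse; a later loop turns it round while duplicating it.
theorem run_transferOut {k : K} [Finite (Γ k)]
    (R' : Module.Reader (Sum.elim (WkSym L L' A) Γ) σ (.inr k)) (g : Γ k → Option (Option A))
    (T : ∀ k, List (Γ k)) (l : List (Γ k)) (r : List (Option A)) :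
    (transferOut R' g).Run (combine { s with raw := r }.get (Function.update T k l))
      (combine { s with raw := (l.filterMap g).reverse ++ r }.get (Function.update T k []))
      (2 * l.length + 1) := by
  have : Finite (Sum.elim (WkSym L L' A) Γ (.inr k)) := ‹Finite (Γ k)›
  induction l generalizing r with
  | nil =>
    refine (Module.run_loop_nil R' _ ?_).of_eq rfl ?_
    · exact Function.update_self ..
    · simp
  | cons a l ih =>
    have hpop : Function.update
        (combine { s with raw := r }.get (Function.update T k (a :: l))) (.inr k) l =
        combine { s with raw := r }.get (Function.update T k l) :=
      (update_combine_inr ..).trans (by rw [Function.update_idem])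
    refine (Module.run_loop_cons R' (a := a) (l := l) (t := 1) (t' := 2 * l.length + 1)
      (S' := combine { s with raw := (g a).toList ++ r }.get (Function.update T k l)) ?_ ?_
      ((ih _).of_eq rfl ?_)).mono (by simp; omega)
    · exact Function.update_self ..
    · rw [hpop]
      cases hg : g a with
      | none => exact Module.run_skip _
      | some o => exact does_put (s := { s with raw := r })
    · cases hg : g a <;> simp [hg]

end Transfer

/-- The symbols of an enumeration of tuples; the ends of the adversaries are ignored. -/
def rowSym {A : Type} : AdvSym A → Option (Option A)
  | .elem a => some (some a)
  | .tupleEnd => some none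
  | .advEnd => none

/-- The reduction only needs the union of the adversaries, so their boundaries may be forgotten. -/
theorem filterMap_encodeAdversaries {A : Type} {m : ℕ} (l : List (List (Fin m → A))) :
    (encodeAdversaries l).filterMap rowSym = (l.flatten.map List.ofFn).flatMap rowWord := by
  have h₁ : ∀ t : List A, (t.map AdvSym.elem).filterMap rowSym = t.map some := fun t => by
    induction t <;> simp_all [rowSym]
  have h₂ : ∀ B : List (Fin m → A),
      (B.map fun t => (List.ofFn t).map AdvSym.elem ++ [AdvSym.tupleEnd]).flatten.filterMap rowSym =
        (B.map List.ofFn).flatMap rowWord := fun B => by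
    induction B with
    | nil => rfl
    | cons t B ih =>
      simp only [List.map_cons, List.flatten_cons, List.filterMap_append, ih, h₁,
        List.flatMap_cons, rowWord]
      simp [rowSym]
  induction l with
  | nil => rfl
  | cons B l ih =>
    simp only [encodeAdversaries, List.map_cons, List.flatten_cons, List.filterMap_append] at ih ⊢
    rw [ih, h₂]
    simp [rowSym]

/-! ### The whole program and its running time -/

section Machine

variable {L L' : FirstOrder.Language.{0, 0}} {A : Type} [DecidableEq A] {K : Type} [DecidableEq K]
  {Γ : K → Type} {Λ ρ σ : Type} [Finite (Sym L)] [Finite (Sym L')] [Finite A] [Finite Λ]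
  (R : Readers L L' A Γ (ρ × σ)) (φ : L →ᴸ L') (name : A → L'.Constants)

/-- The program of the reduction. -/
def reduceProg (k₀ : K) (u : Γ k₀) {k₁ : K} [Finite (Γ k₁)]
    (R' : Module.Reader (Sum.elim (WkSym L L' A) Γ) (ρ × σ) (.inr k₁))
    (g : Γ k₁ → Option (Option A)) (main : Λ) (init : σ) (M : Λ → Turing.TM2.Stmt Γ Λ σ) :
    Prog L L' A Γ (ρ × σ) :=
  (load R).seq <| (transferIn R k₀ u).seq <| (Module.call main init M).seq <|
  (transferOut R' g).seq <| (each R .raw fun o => (put .rows o).seq (put .rowsC o)).seq <|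
  (rowsProg R φ name).seq (finish R)

variable {R φ name}

omit [DecidableEq A] [Finite (Sym L)] [Finite (Sym L')] [Finite A] in
-- Bounds the length of the output by the time spent writing it, which avoids estimating `atomsWord`
-- directly.
theorem length_acc_le [Nonempty ρ] [Nonempty σ] (P : Prog L L' A Γ (ρ × σ)) :
    ∃ b, ∀ T s s' t, Does T P s s' t → s'.acc.length ≤ s.acc.length + b * t := by
  have := P.finite_label
  obtain ⟨b, hb⟩ := Steps.exists_length_le P.code
  refine ⟨b, fun T s s' t h => ?_⟩
  obtain ⟨v', n, hn, h'⟩ := h (Classical.arbitrary _)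
  exact (hb _ _ _ h' (.inl .acc)).trans (by gcongr; exact le_rfl)

/-- The polynomial depends on the programs only. The enumerator's time `t` is added separately, and
`n` bounds both the input and the enumerator's output. -/
theorem exists_run_reduceProg [Nonempty ρ] [Nonempty σ] (k₀ : K) (u : Γ k₀) {k₁ : K}
    [Finite (Γ k₁)]
    (R' : Module.Reader (Sum.elim (WkSym L L' A) Γ) (ρ × σ) (.inr k₁))
    (g : Γ k₁ → Option (Option A)) (main : Λ) (init : σ) (M : Λ → Turing.TM2.Stmt Γ Λ σ) :
    ∃ p : Polynomial ℕ, ∀ (qs : List Quantifier) (w : List (Sym L)) (l : List (Γ k₁))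
      (rs : List (List A)) (v' : σ) (t n : ℕ), (∀ q, Sym.quant q ∉ w) →
      Steps M t
        ⟨some main, init, Function.update (fun _ => []) k₀ (replicate (qs.length + 1) u)⟩
        ⟨none, v', Function.update (fun _ => []) k₁ l⟩ →
      l.filterMap g = rs.flatMap rowWord → (∀ r ∈ rs, r.length = qs.length + 1) →
      w.length + qs.length + 1 ≤ n → l.length ≤ n →
      (reduceProg R φ name k₀ u R' g main init M).Run
        (combine { inp := qs.map Sym.quant ++ w : Stacks L L' A }.get fun _ => [])
        (combine { outp := replicate (rs.length * qs.length) (Sym.quant .ex) ++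
          atomsWord φ name qs w rs : Stacks L L' A }.get fun _ => []) (p.eval n + t) := by
  obtain ⟨b, hb⟩ := length_acc_le (rowsProg R φ name)
  refine ⟨(2 * Polynomial.C b + 1) * (.X * (.X * (.X * (22 * .X + 18) + 19 * .X + 22) +
    .X * (5 * .X + 5) + 17 * .X + 21) + 1) + 22 * .X + 20, ?_⟩
  intro qs w l rs v' t n hw hM hl hrs hn hln
  -- A row has `N + 1` entries and an end mark. Hence the length of the enumeration bounds the
  -- number of rows as well as the number `rs.length * N` of variables.
  have hwords : (rs.flatMap rowWord).length = rs.length * (qs.length + 2) := by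
    clear hl
    induction rs with
    | nil => simp
    | cons r rs ih =>
      rw [List.flatMap_cons, List.length_append, ih fun r hr => hrs r (by simp [hr])]
      simp [rowWord, hrs r (by simp), Nat.succ_mul]
      omega
  have hwn : (rs.flatMap rowWord).length ≤ n := by
    rw [← hl]
    exact (List.length_filterMap_le _ _).trans hln
  have hrn : rs.length ≤ n := by
    refine le_trans ?_ (hwords.symm.trans_le hwn)
    exact Nat.le_mul_of_pos_right _ (by omega)
  have hyn : rs.length * qs.length ≤ n := by
    refine le_trans ?_ (hwords.symm.trans_le hwn)
    gcongr
    omega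
  have hrs' : ∀ r ∈ rs, qs.length ≤ r.length ∧ r.length ≤ n := fun r hr => by
    rw [hrs r hr]; omega
  have h₁ : Does (fun k => ([] : List (Γ k))) (load R)
      { inp := qs.map Sym.quant ++ w : Stacks L L' A }
      { qs := qs, mat := w, ix := replicate (qs.length + 1) () : Stacks L L' A } _ :=
    does_load (R := R) (n := n) {} hw (by omega)
  have h₂ := run_transferIn (R := R) { qs := qs, mat := w : Stacks L L' A } (fun _ => []) k₀ u
    (qs.length + 1)
  rw [List.append_nil] at h₂
  have h₃ := Module.run_call (ρ := ρ) ({ qs := qs, mat := w : Stacks L L' A }.get) hM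
  have h₄ := run_transferOut { qs := qs, mat := w : Stacks L L' A } R' g (fun _ => []) l []
  rw [hl, Function.update_eq_self_iff.2 rfl, List.append_nil] at h₄
  have h₅ : Does (fun k => ([] : List (Γ k)))
      (each R .raw fun o => (put .rows o).seq (put .rowsC o))
      { qs := qs, mat := w, raw := (rs.flatMap rowWord).reverse : Stacks L L' A }
      { qs := qs, mat := w, rows := rs.flatMap rowWord, rowsC := rs.flatMap rowWord } _ :=
    does_each (w := .raw) (l := (rs.flatMap rowWord).reverse) (n := n) (t := 2)
      (fun d => { qs := qs, mat := w, rows := d.reverse, rowsC := d.reverse })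
      (by simpa using hwn) rfl (by simp [Stacks.upd])
      fun d a r _ r' => Does.of_eq (Does.seq does_put does_put)
        (by simp [Stacks.upd, Stacks.get]) le_rfl
  have h₆ := does_rowsProg (T := fun k => ([] : List (Γ k))) (R := R) (φ := φ) (name := name)
    (n := n) {} (w := w) (by omega) (by omega) hrs' hwn hrn hyn
  have hacc := hb _ _ _ _ h₆
  simp only [List.append_nil, List.length_reverse, List.length_nil, Nat.zero_add] at hacc h₆
  have h₇ := does_finish (T := fun k => ([] : List (Γ k))) (R := R) (n := n) {} (qs := qs)
    (rw := rs.flatMap rowWord) (x := rs.length * qs.length) (w := w)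
    (u := atomsWord φ name qs w rs) (by omega) (by omega) hwn hyn hacc
  have j₆ := Does.seq h₆ h₇
  have j₅ := Does.seq h₅ j₆
  have j₄ := Module.Run.seq h₄ j₅
  have j₃ := Module.Run.seq h₃ j₄
  have j₂ := Module.Run.seq h₂ j₃
  have j₁ := Module.Run.seq h₁ j₂
  refine Module.Run.mono j₁ ?_
  clear j₁ j₂ j₃ j₄ j₅ j₆ h₁ h₂ h₃ h₄ h₅ h₆ h₇
  simp only [Polynomial.eval_add, Polynomial.eval_mul, Polynomial.eval_X, Polynomial.eval_C,
    Polynomial.eval_one, Polynomial.eval_ofNat]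
  -- The time of `rowsProg` is made opaque, so that the remaining inequality is linear.
  obtain ⟨z, hz⟩ : ∃ z, z = n * (n * (n * (22 * n + 18) + 19 * n + 22) + n * (5 * n + 5) +
    17 * n + 21) + 1 := ⟨_, rfl⟩
  rw [← hz]
  clear hz
  have : (2 * b + 1) * z = 2 * (b * z) + z := by ring
  omega

end Machine

end QCSPReduction

namespace QCSPReduction

open scoped FirstOrder
open List

/-! ### The reduction -/

section Map

variable {L L' : FirstOrder.Language.{0, 0}} {V W : Type} (φ : L →ᴸ L') (f : V → W)

/-- Rename variables and transfer to another language. -/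
def Tm.map : Tm L V → Tm L' W
  | .var x => .var (f x)
  | .const c => .const (φ.onFunction c)

/-- Rename variables and transfer to another language. -/
def Atom.map : Atom L V → Atom L' W
  | .rel k r ts => .rel k (φ.onRelation r) fun i => (ts i).map φ f
  | .eq s t => .eq (s.map φ f) (t.map φ f)

/-- The word of a term, the variables having the given indices. -/
def Tm.word (ix : V → ℕ) : Tm L V → List (Sym L)
  | .var x => varWord L (ix x)
  | .const c => [Sym.const c]

/-- The word of an atom, the variables having the given indices. -/
def Atom.word (ix : V → ℕ) : Atom L V → List (Sym L)
  | .rel k r ts => Sym.rel k r :: (List.ofFn fun i => (ts i).word ix).flatten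
  | .eq s t => Sym.eq :: (s.word ix ++ t.word ix)

theorem Tm.encode_eq_word {N : ℕ} (t : Tm L (Fin N)) : t.encode = t.word Fin.val := by
  cases t <;> rfl

theorem Atom.encode_eq_word {N : ℕ} (α : Atom L (Fin N)) : α.encode = α.word Fin.val := by
  cases α <;> simp [Atom.encode, Atom.word, Tm.encode_eq_word]

theorem Tm.word_map_id (ix : W → ℕ) (t : Tm L V) :
    (t.map (FirstOrder.Language.LHom.id L) f).word ix = t.word (ix ∘ f) := by
  cases t <;> rfl

theorem Atom.word_map_id (ix : W → ℕ) (α : Atom L V) :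
    (α.map (FirstOrder.Language.LHom.id L) f).word ix = α.word (ix ∘ f) := by
  cases α <;> simp [Atom.map, Atom.word, Tm.word_map_id]

theorem shiftWord_append (x : ℕ) (w w' : List (Sym L)) :
    shiftWord φ x (w ++ w') = shiftWord φ x w ++ shiftWord φ x w' := by
  simp [shiftWord]

theorem shiftWord_flatten (x : ℕ) (l : List (List (Sym L))) :
    shiftWord φ x l.flatten = (l.map (shiftWord φ x)).flatten := by
  induction l with
  | nil => rfl
  | cons w l ih => simp [shiftWord_append, ih]

theorem shiftWord_replicate_tick (x n : ℕ) :
    shiftWord φ x (replicate n Sym.tick) = replicate n Sym.tick := by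
  induction n with
  | zero => rfl
  | succ n ih =>
    rw [replicate_succ, ← singleton_append, shiftWord_append, ih]
    rfl

/-- If `f` raises indices by `x`, renaming along `f` and shifting the word have the same effect;
used with `f i = (r, i)` and `x = r * N`. -/
theorem Tm.word_map_shift (ix : V → ℕ) (ix' : W → ℕ) (x : ℕ) (h : ∀ v, ix' (f v) = x + ix v)
    (t : Tm L V) : (t.map φ f).word ix' = shiftWord φ x (t.word ix) := by
  cases t with
  | var v =>
    have : shiftWord φ x (varWord L (ix v)) = varWord L' x ++ shiftWord φ x (replicate (ix v) .tick) :=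
      rfl
    simp only [Tm.map, Tm.word, h, this, shiftWord_replicate_tick]
    simp [varWord, replicate_append_replicate]
  | const c => rfl

theorem Atom.word_map_shift (ix : V → ℕ) (ix' : W → ℕ) (x : ℕ) (h : ∀ v, ix' (f v) = x + ix v)
    (α : Atom L V) : (α.map φ f).word ix' = shiftWord φ x (α.word ix) := by
  cases α with
  | rel k r ts =>
    have : ∀ l, shiftWord φ x (Sym.rel k r :: l) = Sym.rel k (φ.onRelation r) :: shiftWord φ x l :=
      fun _ => rfl
    simp [Atom.map, Atom.word, this, shiftWord_flatten, Tm.word_map_shift φ f ix ix' x h, map_ofFn,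
      Function.comp_def]
  | eq s t =>
    have : ∀ l, shiftWord φ x (Sym.eq :: l) = Sym.eq :: shiftWord φ x l := fun _ => rfl
    simp [Atom.map, Atom.word, this, shiftWord_append, Tm.word_map_shift φ f ix ix' x h]

variable {A : Type} [L.Structure A] [L'.Structure A] [φ.IsExpansionOn A]

theorem Tm.eval_map (v : W → A) (t : Tm L V) : (t.map φ f).eval v = t.eval (v ∘ f) := by
  cases t with
  | var x => rfl
  | const c => exact FirstOrder.Language.LHom.map_onFunction φ (M := A) c default

theorem Atom.holds_map (v : W → A) (α : Atom L V) :
    (α.map φ f).Holds v ↔ α.Holds (v ∘ f) := by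
  cases α with
  | rel k r ts =>
    simp only [Atom.map, Atom.Holds, Tm.eval_map]
    exact Iff.of_eq (FirstOrder.Language.LHom.map_onRelation φ (M := A) r _)
  | eq s t => simp only [Atom.map, Atom.Holds, Tm.eval_map]

end Map

/-- The rows `t` and `t'` agree on the positions before `i`. -/
abbrev AgreeBefore {A : Type} {N : ℕ} (t t' : Fin (N + 1) → A) (i : Fin N) : Prop :=
  ∀ j : Fin N, j < i → t j.castSucc = t' j.castSucc

theorem zipIdx_flatMap {α β : Type} (l : List α) (g : α × ℕ → List β) :
    l.zipIdx.flatMap g = (finRange l.length).flatMap fun r : Fin l.length => g (l[r], r) := by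
  have : l.zipIdx = (finRange l.length).map fun r : Fin l.length => (l[r], (r : ℕ)) := by
    apply ext_getElem <;> simp
  rw [this, flatMap_map]

theorem range_flatMap {β : Type} (n : ℕ) (g : ℕ → List β) :
    (List.range n).flatMap g = (finRange n).flatMap fun i : Fin n => g i := by
  have : List.range n = (finRange n).map Fin.val := by
    apply ext_getElem <;> simp
  rw [this, flatMap_map]

/-- Links the prefix test in `pairWord` with the condition in `rowAtoms`. -/
theorem take_ofFn_eq_iff {A : Type} {N : ℕ} (t t' : Fin (N + 1) → A) (i : Fin N) :
    (ofFn t).take i = (ofFn t').take i ↔ AgreeBefore t t' i := by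
  constructor
  · intro h j hj
    have := congrArg (fun l => l[(j : ℕ)]?) h
    have hj' : (j : ℕ) < i := hj
    have hN : (j : ℕ) < N + 1 := by omega
    simp only [List.getElem?_take, hj', if_true, List.getElem?_ofFn, hN, dif_pos,
      Option.some.injEq] at this
    exact this
  · intro h
    apply ext_getElem
    · simp
    · intro j h₁ h₂
      simp only [length_take, length_ofFn, lt_inf_iff] at h₁
      simp only [List.getElem_take, List.getElem_ofFn]
      exact h ⟨j, by omega⟩ (Fin.lt_def.2 h₁.1)

section Reduce

variable {L L' : FirstOrder.Language.{0, 0}} {A : Type} [DecidableEq A] (φ : L →ᴸ L')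
  (name : A → L'.Constants) (ψ : PHSentence L)
  (rows : List (Fin (ψ.quants.length + 1) → A))

/-- The value of a universal variable, or the identification of two copies of an existential one. -/
def cellAtom (r r' : Fin rows.length) (i : Fin ψ.quants.length) :
    Atom L' (Fin rows.length × Fin ψ.quants.length) :=
  match ψ.quants[i] with
  | .all => .eq (.var (r, i)) (.const (name (rows[r] i.castSucc)))
  | .ex => .eq (.var (r, i)) (.var (r', i))

/-- The atoms for a row: a copy of the matrix, and the equalities of this row with each row. -/
def rowAtoms (r : Fin rows.length) : List (Atom L' (Fin rows.length × Fin ψ.quants.length)) :=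
  ψ.matrix.map (Atom.map φ fun i => (r, i)) ++
    (finRange rows.length).flatMap fun r' => (finRange ψ.quants.length).flatMap fun i =>
      if AgreeBefore rows[r] rows[r'] i then [cellAtom name ψ rows r r' i] else []

/-- The primitive positive sentence to which `ψ` is reduced. -/
def reduce : PPSentence L' where
  val :=
    { quants := replicate (rows.length * ψ.quants.length) .ex
      matrix := ((finRange rows.length).flatMap (rowAtoms φ name ψ rows)).map
        (Atom.map (FirstOrder.Language.LHom.id L')
          (Fin.cast (length_replicate ..).symm ∘ finProdFinEquiv)) }
  property _ hq := (mem_replicate.1 hq).2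

/-- Variable `(r, i)` has index `r * N + i` under `finProdFinEquiv`, which is the offset plus `i`
used in the words; the two sides then match row by row and cell by cell. -/
theorem encode_reduce :
    (reduce φ name ψ rows).encode = replicate (rows.length * ψ.quants.length) (Sym.quant .ex) ++
      atomsWord φ name ψ.quants (ψ.matrix.map Atom.encode).flatten (rows.map List.ofFn) := by
  have hix : ∀ p : Fin rows.length × Fin ψ.quants.length,
      (finProdFinEquiv p : ℕ) = p.1 * ψ.quants.length + p.2 := fun p => by
    simp [finProdFinEquiv, Nat.mul_comm, Nat.add_comm]
  simp only [PPSentence.encode, PHSentence.encode, reduce, List.map_replicate, List.map_map]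
  congr 1
  have henc : Atom.encode ∘ Atom.map (FirstOrder.Language.LHom.id L')
      (Fin.cast (length_replicate (n := rows.length * ψ.quants.length)
        (a := Quantifier.ex)).symm ∘ finProdFinEquiv) =
      Atom.word (L := L') fun p : Fin rows.length × Fin ψ.quants.length =>
        (p.1 * ψ.quants.length + p.2 : ℕ) := by
    funext α
    rw [Function.comp_apply, Atom.encode_eq_word, Atom.word_map_id]
    congr 1
    funext p
    exact hix p
  rw [henc, ← flatMap_def, flatMap_assoc]
  unfold atomsWord
  rw [zipIdx_map, flatMap_map, zipIdx_flatMap]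
  congr 1
  funext r
  simp only [rowAtoms, rowAtomsWord, flatMap_append, Prod.map]
  congr 1
  · rw [flatMap_map, shiftWord_flatten, flatMap_def, List.map_map]
    congr 2
    funext α
    rw [Function.comp_apply, Atom.encode_eq_word]
    exact Atom.word_map_shift φ (fun i => (r, i)) Fin.val _ _ (fun _ => rfl) α
  · rw [zipIdx_map, flatMap_map, zipIdx_flatMap, flatMap_assoc]
    congr 1
    funext r'
    rw [flatMap_assoc, pairWord, range_flatMap]
    congr 1
    funext i
    simp only [Prod.map, take_ofFn_eq_iff, id]
    split_ifs with h
    · have h₁ : ψ.quants[(i : ℕ)]? = some ψ.quants[i] := by simp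
      have h₂ : (ofFn rows[r])[(i : ℕ)]? = some (rows[r] i.castSucc) := by
        have : (i : ℕ) < ψ.quants.length + 1 := by omega
        rw [List.getElem?_ofFn, dif_pos this]
        rfl
      rw [h₁, h₂]
      simp only [flatMap_singleton, cellAtom]
      cases ψ.quants[i] <;> simp [cellWord, Atom.word, Tm.word, Nat.add_comm]
    · rfl

end Reduce

end QCSPReduction

namespace QCSPReduction

open scoped FirstOrder
open List

/-! ### Correctness of the reduction -/

/-! ### Quantifier prefixes and strategies -/

section Strategy

variable {A : Type}

theorem prefixHolds_of_forall_ex : ∀ (qs : List Quantifier) (_ : ∀ q ∈ qs, q = .ex)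
    (P : (Fin qs.length → A) → Prop), PrefixHolds A qs P ↔ ∃ v, P v
  | [], _, P => by
    rw [PrefixHolds]
    exact ⟨fun h => ⟨_, h⟩, fun ⟨v, h⟩ => by rwa [Subsingleton.elim Fin.elim0 v]⟩
  | q :: qs, h, P => by
    obtain rfl : q = .ex := h q (by simp)
    simp only [PrefixHolds, prefixHolds_of_forall_ex qs fun q hq => h q (by simp [hq])]
    exact (Fin.exists_fin_succ_pi (P := P)).symm

/-- `F` is a winning strategy for the existential player: the value of a variable only depends on
the entries of `x` before it, and the value of a universal variable is its entry in `x`. -/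
def IsStrategy (qs : List Quantifier) (P : (Fin qs.length → A) → Prop)
    (F : (Fin qs.length → A) → Fin qs.length → A) : Prop :=
  (∀ x i, qs[i] = .all → F x i = x i) ∧
  (∀ x x' i, qs[i] = .ex → (∀ j < i, x j = x' j) → F x i = F x' i) ∧ ∀ x, P (F x)

/-- By induction on the prefix, gluing the strategies for the first values of a universal variable.
Entries of `x` at existential positions are dummies; allowing dependence on them gives nothing new,
as they can be fixed in advance. -/
theorem prefixHolds_iff_exists_isStrategy [Nonempty A] : ∀ (qs : List Quantifier)
    (P : (Fin qs.length → A) → Prop), PrefixHolds A qs P ↔ ∃ F, IsStrategy qs P F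
  | [], P => by
    rw [PrefixHolds]
    constructor
    · refine fun h => ⟨id, fun x i => i.elim0, fun x x' i => i.elim0, fun x => ?_⟩
      rwa [show id x = Fin.elim0 from funext fun i => i.elim0]
    · rintro ⟨F, -, -, h⟩
      rw [show Fin.elim0 = F Fin.elim0 from funext fun i => i.elim0]
      exact h _
  | .all :: qs, P => by
    simp only [PrefixHolds, prefixHolds_iff_exists_isStrategy qs]
    constructor
    · intro h
      choose F h₁ h₂ h₃ using h
      refine ⟨fun x => Fin.cons (x 0) (F (x 0) (Fin.tail x)), fun x i => ?_, fun x x' i => ?_,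
        fun x => h₃ _ _⟩
      · refine Fin.cases (fun _ => rfl) (fun i hi => ?_) i
        exact h₁ (x 0) (Fin.tail x) i hi
      · refine Fin.cases (fun hi => nomatch hi) (fun i hi hx => ?_) i
        have hx0 : x 0 = x' 0 := hx 0 (Fin.succ_pos i)
        simp only [Fin.cons_succ, hx0]
        exact h₂ _ _ _ i hi fun j hj => hx j.succ (Fin.succ_lt_succ_iff.2 hj)
    · rintro ⟨F, h₁, h₂, h₃⟩ a
      refine ⟨fun y => Fin.tail (F (Fin.cons a y)), fun y i hi => ?_, fun y y' i hi hy => ?_,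
        fun y => ?_⟩
      · exact h₁ (Fin.cons a y) i.succ hi
      · refine h₂ (Fin.cons a y) (Fin.cons a y') i.succ hi fun j => ?_
        exact Fin.cases (fun _ => rfl) (fun j hj => hy j (Fin.succ_lt_succ_iff.1 hj)) j
      · have := h₃ (Fin.cons a y)
        rwa [← Fin.cons_self_tail (F _), h₁ _ 0 rfl] at this
  | .ex :: qs, P => by
    simp only [PrefixHolds, prefixHolds_iff_exists_isStrategy qs]
    obtain ⟨a₀⟩ := ‹Nonempty A›
    constructor
    · rintro ⟨a, F, h₁, h₂, h₃⟩
      refine ⟨fun x => Fin.cons a (F (Fin.tail x)), fun x i => ?_, fun x x' i => ?_,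
        fun x => h₃ _⟩
      · refine Fin.cases (fun hi => nomatch hi) (fun i hi => ?_) i
        exact h₁ (Fin.tail x) i hi
      · refine Fin.cases (fun _ _ => rfl) (fun i hi hx => ?_) i
        exact h₂ _ _ i hi fun j hj => hx j.succ (Fin.succ_lt_succ_iff.2 hj)
    · rintro ⟨F, h₁, h₂, h₃⟩
      -- No entry precedes position `0`, so `F x 0` is constant and any `x` computes it; `a₀` fills
      -- the dummy entry.
      refine ⟨F (fun _ => a₀) 0, fun y => Fin.tail (F (Fin.cons a₀ y)), fun y i hi => ?_,
        fun y y' i hi hy => ?_, fun y => ?_⟩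
      · exact h₁ (Fin.cons a₀ y) i.succ hi
      · refine h₂ (Fin.cons a₀ y) (Fin.cons a₀ y') i.succ hi fun j => ?_
        exact Fin.cases (fun _ => rfl) (fun j hj => hy j (Fin.succ_lt_succ_iff.1 hj)) j
      · have := h₃ (Fin.cons a₀ y)
        rwa [← Fin.cons_self_tail (F _), h₂ _ (fun _ => a₀) 0 rfl fun j hj => absurd hj (by simp)]
          at this

end Strategy

/-! ### Polymorphisms preserve the truth of atoms -/

section Polymorphism

variable {L : FirstOrder.Language.{0, 0}} {A : Type} [L.Structure A] {V : Type} {k : ℕ}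

theorem Tm.eval_polymorphism (f : Polymorphism L A k) (v : Fin k → V → A) (t : Tm L V) :
    t.eval (fun x => f fun r => v r x) = f fun r => t.eval (v r) := by
  cases t with
  | var x => rfl
  | const c =>
    refine (FirstOrder.Language.Hom.map_constants f c).symm.trans (congrArg f ?_)
    funext r
    exact congrArg (FirstOrder.Language.Structure.funMap (M := A) c)
      (funext fun i : Fin 0 => i.elim0)

theorem Atom.holds_polymorphism (f : Polymorphism L A k) (v : Fin k → V → A) (α : Atom L V)
    (h : ∀ r, α.Holds (v r)) : α.Holds fun x => f fun r => v r x := by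
  cases α with
  | rel l R ts =>
    simp only [Atom.Holds, Tm.eval_polymorphism]
    exact f.map_rel R (fun i r => (ts i).eval (v r)) fun r => h r
  | eq s t =>
    simp only [Atom.Holds, Tm.eval_polymorphism]
    exact congrArg f (funext h)

end Polymorphism

/-! ### The primitive positive sentence is equivalent to `ψ` -/

section Correctness

variable {L L' : FirstOrder.Language.{0, 0}} {A : Type} [L.Structure A] [L'.Structure A]
  (φ : L →ᴸ L') [φ.IsExpansionOn A] [DecidableEq A] (name : A → L'.Constants) (ψ : PHSentence L)
  (rows : List (Fin (ψ.quants.length + 1) → A))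

/-- Reads the sentence as a strategy `g` restricted to the rows. The case `r = r'` already fixes all
universal variables, since a row agrees with itself. -/
theorem reduce_mem_csp_iff (hname : ∀ t ∈ rows, ∀ i, (name (t i) : A) = t i) :
    reduce φ name ψ rows ∈ CSP L' A ↔ ∃ g : Fin rows.length → Fin ψ.quants.length → A,
      (∀ r, ∀ α ∈ ψ.matrix, α.Holds (g r)) ∧
      ∀ r r' i, AgreeBefore rows[r] rows[r'] i →
        (ψ.quants[i] = .all → g r i = rows[r] i.castSucc) ∧
        (ψ.quants[i] = .ex → g r i = g r' i) := by
  have hcell : ∀ (v : Fin rows.length × Fin ψ.quants.length → A) r r' i,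
      (cellAtom name ψ rows r r' i).Holds v ↔
        (ψ.quants[i] = .all → v (r, i) = rows[r] i.castSucc) ∧
        (ψ.quants[i] = .ex → v (r, i) = v (r', i)) := fun v r r' i => by
    unfold cellAtom
    have := hname rows[r] (getElem_mem _) i.castSucc
    cases ψ.quants[i] <;>
      simp only [Atom.Holds, Tm.eval, this, forall_const, reduceCtorEq, false_implies, and_true,
        true_and]
  have hmain : reduce φ name ψ rows ∈ CSP L' A ↔
      ∃ v : Fin rows.length × Fin ψ.quants.length → A,
        ∀ r, ∀ α ∈ rowAtoms φ name ψ rows r, α.Holds v := by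
    refine (prefixHolds_of_forall_ex _ (reduce φ name ψ rows).2 _).trans ?_
    let e : Fin rows.length × Fin ψ.quants.length ≃
        Fin (reduce φ name ψ rows).1.quants.length :=
      finProdFinEquiv.trans (finCongr (length_replicate ..).symm)
    have key : ∀ v : Fin (reduce φ name ψ rows).1.quants.length → A,
        (∀ α ∈ (reduce φ name ψ rows).1.matrix, α.Holds v) ↔
          ∀ r, ∀ α ∈ rowAtoms φ name ψ rows r, α.Holds (v ∘ e) := fun v => by
      constructor
      · intro h r α hα
        exact (Atom.holds_map _ _ _ _).1
          (h _ (mem_map_of_mem (mem_flatMap.2 ⟨r, mem_finRange r, hα⟩)))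
      · intro h β hβ
        obtain ⟨α, hα, rfl⟩ := mem_map.1 hβ
        obtain ⟨r, -, hα⟩ := mem_flatMap.1 hα
        exact (Atom.holds_map _ _ _ _).2 (h r α hα)
    constructor
    · rintro ⟨v, hv⟩
      exact ⟨v ∘ e, (key v).1 hv⟩
    · rintro ⟨v, hv⟩
      refine ⟨v ∘ e.symm, (key _).2 ?_⟩
      rwa [Function.comp_assoc, e.symm_comp_self, Function.comp_id]
  rw [hmain]
  constructor
  · rintro ⟨v, hv⟩
    refine ⟨fun r i => v (r, i), fun r α hα => ?_, fun r r' i hi => ?_⟩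
    · exact (Atom.holds_map φ _ v α).1 (hv r _ (mem_append_left _ (mem_map_of_mem hα)))
    · refine (hcell v r r' i).1 (hv r _ (mem_append_right _ ?_))
      simp only [mem_flatMap, mem_finRange, true_and]
      exact ⟨r', i, by rw [if_pos hi]; exact mem_singleton_self _⟩
  · rintro ⟨g, h₁, h₂⟩
    refine ⟨fun p => g p.1 p.2, fun r α hα => ?_⟩
    rcases mem_append.1 hα with hα | hα
    · obtain ⟨β, hβ, rfl⟩ := mem_map.1 hα
      exact (Atom.holds_map φ _ _ β).2 (h₁ r β hβ)
    · simp only [mem_flatMap, mem_finRange, true_and] at hα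
      obtain ⟨r', i, hα⟩ := hα
      split_ifs at hα with hi
      · rw [mem_singleton.1 hα]
        exact (hcell _ r r' i).2 (h₂ r r' i hi)
      · simp at hα

theorem mem_qcsp_iff_reduce_mem_csp [Fintype A] [Nonempty A] (Ω : AdversarySeq A)
    (hrows : ∀ t, t ∈ rows ↔ ∃ B ∈ Ω (ψ.quants.length + 1), t ∈ B)
    (hname : ∀ t ∈ rows, ∀ i, (name (t i) : A) = t i) (hProj : Projective Ω)
    (hGen : ∀ m, 1 ≤ m → Generates L (Ω m) Finset.univ) :
    ψ ∈ QCSP L A ↔ reduce φ name ψ rows ∈ CSP L' A := by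
  rw [reduce_mem_csp_iff φ name ψ rows hname]
  refine (prefixHolds_iff_exists_isStrategy _ _).trans ?_
  constructor
  · rintro ⟨F, h₁, h₂, h₃⟩
    -- The strategy is played against each row, whose last entry is ignored.
    refine ⟨fun r => F fun i => rows[r] i.castSucc, fun r => h₃ _, fun r r' i hi => ⟨?_, ?_⟩⟩
    · exact h₁ _ i
    · exact fun hq => h₂ _ _ i hq hi
  · rintro ⟨g, h₁, h₂⟩
    obtain ⟨a₀⟩ := ‹Nonempty A›
    have hcard : 1 ≤ Fintype.card A := Fintype.card_pos_iff.2 ⟨a₀⟩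
    let e := Fintype.equivFin A
    -- Every block of this tuple lists all elements of `A`, so any play can be read off by choosing
    -- one position per block.
    let target : Fin ((ψ.quants.length + 1) * Fintype.card A) → A :=
      fun p => e.symm (finProdFinEquiv.symm p).2
    obtain ⟨k, -, f, ts, hts, hf⟩ := hGen _ (Nat.mul_pos (Nat.succ_pos _) hcard) target
      (Finset.mem_univ _)
    -- Position of `x i` in block `i`; the choice `a₀` in the additional last block is arbitrary.
    let sel (x : Fin ψ.quants.length → A) : Fin (ψ.quants.length + 1) → Fin (Fintype.card A) :=
      Fin.snoc (fun i => e (x i)) (e a₀)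
    have hproj : ∀ r x, (fun j => ts r (finProdFinEquiv (j, sel x j))) ∈ rows := fun r x => by
      obtain ⟨B, hB, ht⟩ := hts r
      obtain ⟨D, hD, hBD⟩ := hProj _ (Nat.succ_pos _) B hB
      exact (hrows _).2 ⟨D, hD, hBD (sel x) (Finset.mem_image_of_mem _ ht)⟩
    have hrow : ∀ r x, ∃ i : Fin rows.length,
        rows[i] = fun j => ts r (finProdFinEquiv (j, sel x j)) := fun r x => by
      obtain ⟨i, hi, h⟩ := getElem_of_mem (hproj r x)
      exact ⟨⟨i, hi⟩, h⟩
    choose row hrow using hrow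
    -- The answer to the play `x` is `f` applied to the answers to the `k` rows selected by `x`.
    refine ⟨fun x i => f fun r => g (row r x) i, fun x i hq => ?_, fun x x' i hq hx => ?_,
      fun x α hα => ?_⟩
    · have : ∀ r, g (row r x) i = ts r (finProdFinEquiv (i.castSucc, e (x i))) := fun r => by
        rw [(h₂ (row r x) (row r x) i fun _ _ => rfl).1 hq, hrow]
        simp [sel]
      simp only [this, hf]
      exact (congrArg (fun p => e.symm p.2)
        (finProdFinEquiv.symm_apply_apply (i.castSucc, e (x i)))).trans (e.symm_apply_apply _)
    -- Plays agreeing before `i` select, for each `r`, rows agreeing before `i`, on which `g` gives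
    -- the same value to the existential variable `i`.
    · refine congrArg f (funext fun r => (h₂ (row r x) (row r x') i fun j hj => ?_).2 hq)
      rw [hrow, hrow]
      simp [sel, hx j hj]
    · exact Atom.holds_polymorphism f (fun r => g (row r x)) α fun r => h₁ _ α hα

end Correctness

end QCSPReduction

namespace QCSPReduction

open List (replicate)

/-! ### The machine of the reduction -/

/-! ### From modules to Turing machines -/

section ToFinTM2

variable {K : Type} [DecidableEq K] [Fintype K] {Γ : K → Type} {σ : Type} [Fintype σ]

/-- Halt in a given internal state. -/
def Module.reset (v₀ : σ) : Module Γ σ :=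
  ⟨Unit, inferInstance, (), fun _ => .load (fun _ => v₀) .halt⟩

/-- The machine running a module. -/
noncomputable def Module.toFinTM2 (P : Module Γ σ) (k₀ k₁ : K) [Fintype (Γ k₀)] (v₀ : σ) :
    Turing.FinTM2 where
  K := K
  k₀ := k₀
  k₁ := k₁
  Γ := Γ
  Λ := (P.seq (reset v₀)).Label
  main := (P.seq (reset v₀)).main
  ΛFin := have := (P.seq (reset v₀)).finite_label; Fintype.ofFinite _
  σ := σ
  initialState := v₀
  m := (P.seq (reset v₀)).code

/-- A `FinTM2` must halt in its initial internal state; the appended `reset` arranges this in one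
step. -/
theorem Module.Run.outputs {P : Module Γ σ} {k₀ k₁ : K} [Fintype (Γ k₀)] (v₀ : σ)
    {x : List (Γ k₀)} {y : List (Γ k₁)} {t : ℕ}
    (h : P.Run (Function.update (fun _ => []) k₀ x) (Function.update (fun _ => []) k₁ y) t) :
    Nonempty (Turing.TM2OutputsInTime (P.toFinTM2 k₀ k₁ v₀) x (some y) (t + 1)) := by
  obtain ⟨v', n, hn, h⟩ := h v₀
  have h₁ := h.relabel (N := (P.seq (reset v₀)).code) .inl (some (.inr ())) fun _ => rfl
  have h₂ : Steps (P.seq (reset v₀)).code 1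
      ⟨some (.inr ()), v', Function.update (fun _ => []) k₁ y⟩
      ⟨none, v₀, Function.update (fun _ => []) k₁ y⟩ := Steps.head rfl (Steps.refl _ _)
  exact TM2OutputsInTime.nonempty_of_steps (n := 1 + n) (by omega) (h₁.trans h₂)

end ToFinTM2

/-! ### Registers and finiteness of the alphabets -/

section Readers

variable (L L' : FirstOrder.Language.{0, 0}) (A : Type) {K : Type} (Γ : K → Type) (τ π σ : Type)

/-- Registers for the work stacks. -/
abbrev Registers : Type := ∀ w, Option (WkSym L L' A w)

/-- Readers for the work stacks, each using its register. -/
def wkReader : Readers L L' A Γ ((Registers L L' A × τ) × σ) := fun w =>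
  { write := fun v o => ((Function.update v.1.1 w o, v.1.2), v.2)
    read := fun v => v.1.1 w
    read_write := fun _ _ => Function.update_self .. }

/-- A reader for a stack of the subroutine. -/
def subReader (k : K) :
    Module.Reader (Sum.elim (WkSym L L' A) Γ) ((π × Option (Γ k)) × σ) (.inr k) where
  write v o := ((v.1.1, o), v.2)
  read v := v.1.2
  read_write _ _ := rfl

end Readers

theorem eval_le_eval (p : Polynomial ℕ) {m n : ℕ} (h : m ≤ n) : p.eval m ≤ p.eval n := by
  simp only [Polynomial.eval_eq_sum_range]
  gcongr

instance : Fintype Wk where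
  elems := {.inp, .outp, .acc, .qs, .qsB, .mat, .matB, .raw, .rows, .rowsC, .rowsB, .elC, .elR,
    .el1, .el2, .elR2, .o1, .o2, .ix, .tk}
  complete w := by cases w <;> simp

theorem Sym.finite {L : FirstOrder.Language.{0, 0}} (h : Finite (Σ k, L.Relations k))
    (h' : Finite L.Constants) : Finite (Sym L) := by
  let f : Sym L → Quantifier ⊕ (Σ k, L.Relations k) ⊕ L.Constants ⊕ Fin 3
    | .quant q => .inl q
    | .rel k r => .inr (.inl ⟨k, r⟩)
    | .const c => .inr (.inr (.inl c))
    | .eq => .inr (.inr (.inr 0))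
    | .var => .inr (.inr (.inr 1))
    | .tick => .inr (.inr (.inr 2))
  refine Finite.of_injective f ?_
  intro a b
  cases a <;> cases b <;> simp +contextual [f]

theorem AdvSym.finite (A : Type) [Finite A] : Finite (AdvSym A) := by
  let f : AdvSym A → A ⊕ Bool
    | .elem a => .inl a
    | .tupleEnd => .inr true
    | .advEnd => .inr false
  refine Finite.of_injective f ?_
  intro a b
  cases a <;> cases b <;> simp +contextual [f]

theorem quant_notMem_word {L : FirstOrder.Language.{0, 0}} {V : Type} (ix : V → ℕ) (q : Quantifier)
    (α : Atom L V) : Sym.quant q ∉ α.word ix := by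
  have ht : ∀ t : Tm L V, Sym.quant q ∉ t.word ix := fun t => by
    cases t <;> simp [Tm.word, varWord]
  cases α with
  | rel k r ts =>
    simp only [Atom.word, List.mem_cons, List.mem_flatten, reduceCtorEq, false_or, not_exists,
      not_and, List.mem_ofFn, forall_exists_index, forall_apply_eq_imp_iff]
    exact fun i => ht _
  | eq s t => simp [Atom.word, ht]

theorem combine_single_inl {L L' : FirstOrder.Language.{0, 0}} {A K : Type} [DecidableEq K]
    {Γ : K → Type} (w : Wk) (x : List (WkSym L L' A w)) :
    combine (({} : Stacks L L' A).upd w x).get (fun k => ([] : List (Γ k))) =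
      Function.update (β := fun k => List (Sum.elim (WkSym L L' A) Γ k)) (fun _ => [])
        (Sum.inl w) x := by
  have h : combine ({} : Stacks L L' A).get (fun k => ([] : List (Γ k))) = fun _ => [] := by
    funext k
    rcases k with w | k
    · cases w <;> rfl
    · rfl
  rw [← h, ← update_combine_get]

/-! ### Assembling the polynomial-time reduction -/

section Main

variable {L L' : FirstOrder.Language.{0, 0}} [Finite (Sym L)] [Finite (Sym L')]
  {A : Type} [Fintype A] [DecidableEq A] [L.Structure A] [L'.Structure A]

/-- The reduction of `QCSP` to the `CSP` of an expansion in which the elements of the adversaries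
are named. -/
theorem polyTimeReducible_of_expansion [Nonempty A] (φ : L →ᴸ L') [φ.IsExpansionOn A]
    (name : A → L'.Constants) (Ω : AdversarySeq A)
    (hname : ∀ m, 1 ≤ m → ∀ B ∈ Ω m, ∀ t ∈ B, ∀ i : Fin m, (name (t i) : A) = t i)
    (hEff : Effective Ω) (hProj : Projective Ω) (hBdd : PolynomiallyBounded Ω)
    (hGen : ∀ m, 1 ≤ m → Generates L (Ω m) Finset.univ) :
    PolyTimeReducible PHSentence.encode PPSentence.encode (QCSP L A) (CSP L' A) := by
  obtain ⟨enum, p, M, hM⟩ := hEff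
  obtain ⟨pb, hpb⟩ := hBdd
  have hrows : ∀ m, 1 ≤ m → ∀ t, t ∈ (enum m).flatten ↔ ∃ B ∈ Ω m, t ∈ B := fun m hm t => by
    rw [← (hM m hm).1]
    simp
  refine ⟨fun ψ => reduce φ name ψ (enum (ψ.quants.length + 1)).flatten, ?_, fun ψ =>
    mem_qcsp_iff_reduce_mem_csp φ name ψ _ Ω (hrows _ (Nat.succ_pos _)) (fun t ht i => ?_)
      hProj hGen⟩
  swap
  · obtain ⟨B, hB, htB⟩ := (hrows _ (Nat.succ_pos _) t).1 ht
    exact hname _ (Nat.succ_pos _) B hB t htB i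
  have := AdvSym.finite A
  have : Finite (M.tm.Γ M.tm.k₁) := Finite.of_equiv _ M.outputAlphabet.symm
  have := M.tm.kFin
  have := M.tm.ΛFin
  have := M.tm.σFin
  have : Fintype (Registers L L' A) := Fintype.ofFinite _
  have : Fintype (Option (M.tm.Γ M.tm.k₁)) := Fintype.ofFinite _
  have : Nonempty M.tm.σ := ⟨M.tm.initialState⟩
  have : Nonempty (Registers L L' A × Option (M.tm.Γ M.tm.k₁)) := ⟨fun _ => none, none⟩
  have : Fintype (Sum.elim (WkSym L L' A) M.tm.Γ (.inl .inp)) :=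
    have : Finite (Sym L) := inferInstance
    @Fintype.ofFinite (Sym L) this
  let P := reduceProg (wkReader L L' A M.tm.Γ (Option (M.tm.Γ M.tm.k₁)) M.tm.σ) φ name
    M.tm.k₀ (M.inputAlphabet.invFun ()) (subReader L L' A M.tm.Γ (Registers L L' A) M.tm.σ M.tm.k₁)
    (rowSym ∘ M.outputAlphabet) M.tm.main M.tm.initialState M.tm.m
  obtain ⟨q, hq⟩ := exists_run_reduceProg
    (R := wkReader L L' A M.tm.Γ (Option (M.tm.Γ M.tm.k₁)) M.tm.σ) (φ := φ) (name := name)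
    M.tm.k₀ (M.inputAlphabet.invFun ()) (subReader L L' A M.tm.Γ (Registers L L' A) M.tm.σ M.tm.k₁)
    (rowSym ∘ M.outputAlphabet) M.tm.main M.tm.initialState M.tm.m
  obtain ⟨b, hb⟩ := Steps.exists_length_le M.tm.m
  -- Bounds the enumerator's time: `m = N + 1` is at most the input length plus one, and the width
  -- of `Ω m` is at most `pb` at `m`.
  let τ : Polynomial ℕ := (p.comp (.X + pb)).comp (.X + 1)
  let time : Polynomial ℕ := q.comp (2 * .X + 2 + .C b * τ) + τ + 1
  have key : ∀ ψ : PHSentence L, P.Run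
      (Function.update (fun _ => []) (.inl .inp) ψ.encode)
      (Function.update (fun _ => []) (.inl .outp)
        (reduce φ name ψ (enum (ψ.quants.length + 1)).flatten).encode)
      ((q.comp (2 * .X + 2 + .C b * τ) + τ).eval ψ.encode.length) := fun ψ => by
    set m := ψ.quants.length + 1 with hm
    have hm1 : 1 ≤ m := Nat.succ_pos _
    obtain ⟨t, ht, hsteps⟩ := TM2OutputsInTime.exists_steps (hM m hm1).2
    rw [List.map_replicate] at hsteps
    set l := (encodeAdversaries (enum m)).map M.outputAlphabet.invFun with hl
    have hlen : ψ.encode.length = (ψ.matrix.map Atom.encode).flatten.length + ψ.quants.length := by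
      simp [PHSentence.encode, Nat.add_comm]
    have htτ : t ≤ τ.eval ψ.encode.length := by
      refine ht.trans ?_
      simp only [τ, Polynomial.eval_comp, Polynomial.eval_add, Polynomial.eval_X,
        Polynomial.eval_one]
      have hmx : m ≤ ψ.encode.length + 1 := by omega
      exact eval_le_eval p (Nat.add_le_add hmx ((hpb m hm1).trans (eval_le_eval pb hmx)))
    -- The enumerator's output stack may coincide with its input stack, hence the summand `m`.
    have hll : l.length ≤ m + b * t := by
      have h := hb _ _ _ hsteps M.tm.k₁
      simp only [Function.update_self] at h
      refine h.trans (Nat.add_le_add_right ?_ _)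
      rcases eq_or_ne M.tm.k₁ M.tm.k₀ with h' | h'
      · rw [h', Function.update_self, List.length_replicate]
      · rw [Function.update_of_ne h']
        exact Nat.zero_le _
    have hfilter : l.filterMap (rowSym ∘ M.outputAlphabet) =
        ((enum m).flatten.map List.ofFn).flatMap rowWord := by
      rw [← filterMap_encodeAdversaries, hl, List.filterMap_map]
      congr 1
      funext x
      simp
    have hrun := hq ψ.quants (ψ.matrix.map Atom.encode).flatten l
      ((enum m).flatten.map List.ofFn) _ t (2 * ψ.encode.length + 2 + b * τ.eval ψ.encode.length)
      (fun q hq => ?_) hsteps hfilter (fun r hr => ?_) (by omega) ?_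
    · have h₁ := combine_single_inl (L := L) (L' := L') (A := A) (Γ := M.tm.Γ) .inp ψ.encode
      have h₂ := combine_single_inl (L := L) (L' := L') (A := A) (Γ := M.tm.Γ) .outp
        (reduce φ name ψ (enum m).flatten).encode
      rw [← h₁, ← h₂, encode_reduce]
      rw [List.length_map] at hrun
      refine hrun.mono ?_
      simp only [Polynomial.eval_comp, Polynomial.eval_add, Polynomial.eval_mul, Polynomial.eval_X,
        Polynomial.eval_C, Polynomial.eval_ofNat]
      gcongr
    · obtain ⟨w, hw, hqw⟩ := List.mem_flatten.1 hq
      obtain ⟨α, -, rfl⟩ := List.mem_map.1 hw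
      rw [Atom.encode_eq_word] at hqw
      exact quant_notMem_word _ _ _ hqw
    · obtain ⟨t, -, rfl⟩ := List.mem_map.1 hr
      simp [hm]
    · have : b * t ≤ b * τ.eval ψ.encode.length := Nat.mul_le_mul_left _ htτ
      omega
  have out : ∀ ψ : PHSentence L, Nonempty (Turing.TM2OutputsInTime
      (P.toFinTM2 (.inl .inp) (.inl .outp) (((fun _ => none), none), M.tm.initialState))
      ψ.encode (some (reduce φ name ψ (enum (ψ.quants.length + 1)).flatten).encode)
      (time.eval ψ.encode.length)) := fun ψ => by
    have h := (key ψ).outputs (((fun _ => none), none), M.tm.initialState)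
    simp only [time, Polynomial.eval_add (p := _ + _), Polynomial.eval_one]
    exact h
  exact ⟨{
    tm := P.toFinTM2 (.inl .inp) (.inl .outp) (((fun _ => none), none), M.tm.initialState)
    inputAlphabet := Equiv.refl (Sym L)
    outputAlphabet := Equiv.refl (Sym L')
    time := time
    outputsFun := fun ψ => by
      -- `outputsFun` speaks of words mapped through the alphabet equivalences, here identities; the
      -- cast removes these maps.
      have e : ∀ {α : Type} (x : List α), x = List.map id x := fun x => (List.map_id x).symm
      exact cast (congrArg₂ (fun (x : List (Sym L)) (y : List (Sym L')) =>
        Turing.TM2OutputsInTime (P.toFinTM2 (.inl .inp) (.inl .outp)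
          (((fun _ => none), none), M.tm.initialState)) x (some y) (time.eval ψ.encode.length))
        (e ψ.encode) (e _)) (out ψ).some }⟩

end Main

end QCSPReduction

/-! ### The theorem -/

theorem mainTheorem8 (L : FirstOrder.Language.{0, 0})
    [∀ k, IsEmpty (L.Functions (k + 1))]
    [Finite (Σ k, L.Relations k)] [Finite L.Constants]
    (A : Type) [Fintype A] [DecidableEq A] [L.Structure A]
    (Ω : QCSPReduction.AdversarySeq A)
    (hNonDeg : ∀ m, 1 ≤ m → QCSPReduction.NonDegenerate (Ω m))
    (hEff : QCSPReduction.Effective Ω)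
    (hProj : QCSPReduction.Projective Ω)
    (hBdd : QCSPReduction.PolynomiallyBounded Ω)
    (hGen : ∀ m, 1 ≤ m → QCSPReduction.Generates L (Ω m) Finset.univ) :
    (∀ (C : Type) [Finite C] (ι : C → A),
      letI : (FirstOrder.Language.constantsOn C).Structure A :=
        FirstOrder.Language.constantsOn.structure ι
      (∀ m, 1 ≤ m → ∀ B ∈ Ω m, ∀ t ∈ B, ∀ i : Fin m,
        ∃ c : (L.withConstants C).Constants, (c : A) = t i) →
      QCSPReduction.PolyTimeReducible
        QCSPReduction.PHSentence.encode QCSPReduction.PPSentence.encode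
        (QCSPReduction.QCSP L A) (QCSPReduction.CSP (L.withConstants C) A)) ∧
    ((∀ a : A, ∃ c : L.Constants, (c : A) = a) →
      QCSPReduction.PolyTimeReducible
        QCSPReduction.PHSentence.encode QCSPReduction.PPSentence.encode
        (QCSPReduction.QCSP L A) (QCSPReduction.CSP L A)) := by
  have : Nonempty A := by
    by_contra h
    rw [not_nonempty_iff] at h
    have h01 : (0 : Fin 2) = 1 :=
      -- Over an empty domain there are no tuples of length `2`, so the two product constants would
      -- coincide.
      hNonDeg 2 (by omega) (funext fun x => isEmptyElim (x.2.1 0))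
    exact absurd h01 (by decide)
  have hL : Finite (QCSPReduction.Sym L) := QCSPReduction.Sym.finite ‹_› ‹_›
  refine ⟨fun C _ ι => ?_, fun hC => ?_⟩
  · let _ : (FirstOrder.Language.constantsOn C).Structure A :=
      FirstOrder.Language.constantsOn.structure ι
    intro hC
    have hL' : Finite (QCSPReduction.Sym (L.withConstants C)) := by
      refine QCSPReduction.Sym.finite ?_ ?_
      · refine Finite.of_injective
          (fun r => r.2.elim (fun s => (⟨r.1, s⟩ : Σ k, L.Relations k)) Empty.elim) ?_
        rintro ⟨k, r | r⟩ ⟨l, s | s⟩ h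
        · cases h
          rfl
        all_goals exact Empty.elim ‹_›
      · have : Finite (L.Functions 0) := ‹Finite L.Constants›
        exact inferInstanceAs (Finite (L.Functions 0 ⊕ C))
    obtain ⟨a₀⟩ := ‹Nonempty A›
    -- Generation at length `1` provides a tuple of an adversary, hence a named element. Its
    -- constant `c₀` is the default for elements without a name, which never occur in rows.
    obtain ⟨k, hk, -, ts, hts, -⟩ := hGen 1 le_rfl (fun _ => a₀) (Finset.mem_univ _)
    obtain ⟨B, hB, ht⟩ := hts ⟨0, hk⟩
    obtain ⟨c₀, -⟩ := hC 1 le_rfl B hB _ ht 0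
    classical
    let name : A → (L.withConstants C).Constants := fun a =>
      if h : ∃ c : (L.withConstants C).Constants, (c : A) = a then h.choose else c₀
    refine QCSPReduction.polyTimeReducible_of_expansion (L.lhomWithConstants C) name Ω
      (fun m hm B hB t ht i => ?_) hEff hProj hBdd hGen
    have h := hC m hm B hB t ht i
    simp only [name, dif_pos h]
    exact h.choose_spec
  · choose name hname using hC
    exact QCSPReduction.polyTimeReducible_of_expansion (FirstOrder.Language.LHom.id L) name Ω
      (fun _ _ _ _ t _ i => hname (t i)) hEff hProj hBdd hGen
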